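/- **Notation.** A noncommutative probability space is a pair $(\mathcal A,\varphi)$ of a unital complex algebra $\mathcal A$ and a linear functional $\varphi:\mathcal A\to\mathbb C$ with $\varphi(1)=1$. Subsets $S_1,S_2\subseteq\mathcal A$ are freely independent if $\varphi(c_1\cdots c_n)=0$ whenever $n\ge 1$, $\varphi(c_j)=0$ for all $j$, each $c_j$ lies in the unital subalgebra generated by $S_{i_j}$, and $i_j\neq i_{j+1}$ for $1\le j<n$. The distribution of $a\in\mathcal A$ is the linear functional $\mu$ on $\mathbb C[X]$ with $\mu(X^n)=\varphi(a^n)$ for all $n\ge 0$. Let $\mathcal G_1$ be the set of linear functionals $\mu:\mathbb C[X]\to\mathbb C$ with $\mu(1)=\mu(X)=1$. For $\mu,\nu\in\mathcal G_1$, let $\mu\boxtimes\nu$ be the distribution of $ab$, where $a,b$ are elements of any noncommutative probability space such that $a$ has distribution $\mu$, $b$ has distribution $\nu$, and $\{a\}$, $\{b\}$ are freely independent. For $\mu\in\mathcal G_1$ put $M_\mu(z)=\sum_{n\ge 1}\mu(X^n)z^n$ and let $$S_\mu(z)=\frac{1+z}{z}\,M_\mu^{\langle -1\rangle}(z)=1+\sum_{n\ge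 1}\beta_n(\mu)\,z^n\in\mathbb C[[z]]$$ be the $S$-transform of $\mu$, where $M_\mu^{\langle -1\rangle}$ is the inverse of $M_\mu$ under composition. Let $\mathrm{Sym}$ be the Hopf algebra of symmetric functions over $\mathbb C$ (the formal power series of bounded degree in $x_0,x_1,\dots$ that are invariant under permutations of the variables), with comultiplication $f\mapsto f(x,y)$ (evaluation at the union of two disjoint alphabets, as an element of $\mathrm{Sym}\otimes\mathrm{Sym}$) and with the constant term as counit. Let $h_n\in\mathrm{Sym}$ be the complete homogeneous symmetric function of degree $n$, and let $\mathbb X(\mathrm{Sym})$ be the group of characters (unital algebra homomorphisms) $\mathrm{Sym}\to\mathbb C$ under convolution, $\eta_1\eta_2=(\eta_1\otimes\eta_2)\circ\Delta$. **Proposition 6.5.** The operation $\boxtimes$ is well defined on $\mathcal G_1$ (elements $a,b$ as above exist, and the distribution of $ab$ depends only on $\mu$ and $\nu$), and $(\mathcal G_1,\boxtimes)$ is a group. For every $\mu\in\mathcal G_1$ there is exactly one character $\theta_\mu\in\mathbb X(\mathrm{Sym})$ with $$\theta_\mu(h_n)=(-1)^n\beta_n(\mu)\qquad\text{for all } n\ge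 1,$$ and the map $\mu\mapsto\theta_\mu$ is a group isomorphism from $(\mathcal G_1,\boxtimes)$ onto $\mathbb X(\mathrm{Sym})$. -/

import Mathlib

open scoped TensorProduct Polynomial

universe u

noncomputable section

/-! ## Symmetric functions in countably many variables -/

namespace SymFun

open MvPowerSeries

/-- The algebra `Sym` of symmetric functions over `ℂ`: formal power series of bounded degree in the
variables `x₀, x₁, x₂, …` which are invariant under all permutations of the variables. -/
def Sym : Subalgebra ℂ (MvPowerSeries ℕ ℂ) where
  carrier := {f | (∀ σ : Equiv.Perm ℕ, renameEquiv ℂ σ f = f) ∧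
    ∃ d : ℕ, ∀ m : ℕ →₀ ℕ, d < m.degree → coeff m f = 0}
  mul_mem' := by
    rintro f g ⟨hf, d, hd⟩ ⟨hg, e, he⟩
    refine ⟨fun σ => by rw [map_mul, hf, hg], d + e, fun m hm => ?_⟩
    rw [coeff_mul]
    refine Finset.sum_eq_zero fun p hp => ?_
    rw [Finset.HasAntidiagonal.mem_antidiagonal] at hp
    have h : p.1.degree + p.2.degree = m.degree := by rw [← hp, map_add]
    rcases lt_or_ge d p.1.degree with h1 | h1
    · rw [hd _ h1, zero_mul]
    · rw [he _ (by omega), mul_zero]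
  add_mem' := by
    rintro f g ⟨hf, d, hd⟩ ⟨hg, e, he⟩
    refine ⟨fun σ => by rw [map_add, hf, hg], max d e, fun m hm => ?_⟩
    rw [map_add, hd _ (lt_of_le_of_lt (le_max_left _ _) hm),
      he _ (lt_of_le_of_lt (le_max_right _ _) hm), add_zero]
  algebraMap_mem' r := by
    refine ⟨fun σ => AlgEquiv.commutes _ _, 0, fun m hm => ?_⟩
    have : m ≠ 0 := by rintro rfl; simp at hm
    classical
    rw [MvPowerSeries.algebraMap_apply, coeff_C, if_neg this]

/-- A finite part of an injective renaming of the variables extends to a permutation. -/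
theorem exists_perm (S : Finset ℕ) (g : ℕ → ℕ) (hg : Set.InjOn g S) :
    ∃ σ : Equiv.Perm ℕ, ∀ x ∈ S, σ x = g x := by
  classical
  let T : Finset ℕ := S ∪ S.image g
  obtain ⟨τ, hτ⟩ := Equiv.Perm.exists_extending_pair
    (fun x : S => (⟨x.1, Finset.mem_union_left _ x.2⟩ : T))
    (fun x : S => (⟨g x.1, Finset.mem_union_right _ (Finset.mem_image_of_mem g x.2)⟩ : T))
    (fun x y h => Subtype.ext (by simpa using h))
    (fun x y h => Subtype.ext (hg x.2 y.2 (by simpa using h)))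
  refine ⟨Equiv.Perm.ofSubtype τ, fun x hx => ?_⟩
  rw [Equiv.Perm.ofSubtype_apply_of_mem τ (Finset.mem_union_left _ hx)]
  have := hτ ⟨x, hx⟩
  simpa using congrArg Subtype.val this

theorem coeff_embDomain_renameEquiv {σ τ : Type*} (e : σ ≃ τ) (f : MvPowerSeries σ ℂ)
    (m : σ →₀ ℕ) : coeff (m.embDomain e.toEmbedding) (renameEquiv ℂ e f) = coeff m f :=
  coeff_embDomain_rename e.toEmbedding f m

theorem coeff_renameEquiv {σ τ : Type*} (e : σ ≃ τ) (f : MvPowerSeries σ ℂ)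
    (m : τ →₀ ℕ) : coeff m (renameEquiv ℂ e f) = coeff (m.embDomain e.symm.toEmbedding) f := by
  rw [← coeff_embDomain_renameEquiv e f]
  congr 2
  refine Finsupp.ext (M := ℕ) fun x => ?_
  have h1 : m x = (m.embDomain e.symm.toEmbedding) (e.symm x) :=
    (Finsupp.embDomain_apply_self e.symm.toEmbedding m x).symm
  have h2 : ((m.embDomain e.symm.toEmbedding).embDomain e.toEmbedding) (e (e.symm x)) =
      (m.embDomain e.symm.toEmbedding) (e.symm x) :=
    Finsupp.embDomain_apply_self e.toEmbedding _ _
  rw [e.apply_symm_apply] at h2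
  rw [h1, h2]

theorem coeff_embDomain {f : MvPowerSeries ℕ ℂ} (hf : f ∈ Sym) (g : ℕ ↪ ℕ) (m : ℕ →₀ ℕ) :
    coeff (m.embDomain g) f = coeff m f := by
  obtain ⟨σ, hσ⟩ := exists_perm m.support g g.injective.injOn
  have h : m.embDomain g = m.embDomain σ.toEmbedding := by
    rw [Finsupp.embDomain_eq_mapDomain, Finsupp.embDomain_eq_mapDomain]
    exact Finsupp.mapDomain_congr fun x hx => (hσ x hx).symm
  rw [h]
  conv_lhs => rw [← hf.1 σ]
  exact coeff_embDomain_renameEquiv σ f m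

/-- A symmetric function may be evaluated at any countable alphabet. -/
theorem renameEquiv_eq {τ : Type*} (e e' : ℕ ≃ τ) {f : MvPowerSeries ℕ ℂ} (hf : f ∈ Sym) :
    renameEquiv ℂ e f = renameEquiv ℂ e' f := by
  have h := hf.1 (e.trans e'.symm)
  rw [← renameEquiv_trans, ← renameEquiv_symm, AlgEquiv.trans_apply] at h
  rw [← (renameEquiv ℂ e').apply_symm_apply (renameEquiv ℂ e f), h]

section Split

variable {σ τ A B A' B' : Type*} [CommRing A] [Algebra ℂ A] [CommRing B] [Algebra ℂ B]
  [CommRing A'] [Algebra ℂ A'] [CommRing B'] [Algebra ℂ B']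

/-- The map `a ⊗ b ↦ i(a)(x) · j(b)(y)` to the power series in two disjoint alphabets. -/
def split (i : A →ₐ[ℂ] MvPowerSeries σ ℂ) (j : B →ₐ[ℂ] MvPowerSeries τ ℂ) :
    A ⊗[ℂ] B →ₐ[ℂ] MvPowerSeries (σ ⊕ τ) ℂ :=
  Algebra.TensorProduct.productMap
    ((rename (R := ℂ) (Function.Embedding.inl : σ ↪ σ ⊕ τ)).comp i)
    ((rename (R := ℂ) (Function.Embedding.inr : τ ↪ σ ⊕ τ)).comp j)

theorem split_tmul (i : A →ₐ[ℂ] MvPowerSeries σ ℂ) (j : B →ₐ[ℂ] MvPowerSeries τ ℂ) (a : A)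
    (b : B) : split i j (a ⊗ₜ b) = rename (R := ℂ) (Function.Embedding.inl : σ ↪ σ ⊕ τ) (i a) *
      rename (R := ℂ) (Function.Embedding.inr : τ ↪ σ ⊕ τ) (j b) := rfl

theorem coeff_split_tmul (i : A →ₐ[ℂ] MvPowerSeries σ ℂ) (j : B →ₐ[ℂ] MvPowerSeries τ ℂ)
    (a : A) (b : B) (α : σ →₀ ℕ) (β : τ →₀ ℕ) :
    coeff (α.sumElim β) (split i j (a ⊗ₜ b)) = coeff α (i a) * coeff β (j b) := by
  classical
  rw [split_tmul, coeff_mul, Finset.sum_eq_single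
    (α.embDomain Function.Embedding.inl, β.embDomain Function.Embedding.inr)]
  · rw [coeff_embDomain_rename, coeff_embDomain_rename]
  · rintro ⟨p, q⟩ hp hne
    rw [Finset.HasAntidiagonal.mem_antidiagonal] at hp
    dsimp only at hp ⊢
    by_contra hcon
    have h1 : p ∈ Set.range (Finsupp.mapDomain (M := ℕ)
        (Function.Embedding.inl : σ ↪ σ ⊕ τ)) := by
      by_contra h; exact hcon (by rw [coeff_rename_eq_zero _ _ h, zero_mul])
    have h2 : q ∈ Set.range (Finsupp.mapDomain (M := ℕ)
        (Function.Embedding.inr : τ ↪ σ ⊕ τ)) := by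
      by_contra h; exact hcon (by rw [coeff_rename_eq_zero _ _ h, mul_zero])
    obtain ⟨p', rfl⟩ := h1
    obtain ⟨q', rfl⟩ := h2
    have h3 : p'.sumElim q' = α.sumElim β := by
      rw [Finsupp.sumElim_eq_add]; exact hp
    have h4 : p' = α := by
      ext x; simpa using DFunLike.congr_fun h3 (Sum.inl x)
    have h5 : q' = β := by
      ext x; simpa using DFunLike.congr_fun h3 (Sum.inr x)
    subst h4 h5
    exact hne (by rw [Finsupp.embDomain_eq_mapDomain, Finsupp.embDomain_eq_mapDomain])
  · intro h
    refine absurd ?_ h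
    rw [Finset.HasAntidiagonal.mem_antidiagonal, Finsupp.sumElim_eq_add, Finsupp.embDomain_eq_mapDomain,
      Finsupp.embDomain_eq_mapDomain]
    rfl

theorem split_injective (i : A →ₐ[ℂ] MvPowerSeries σ ℂ) (j : B →ₐ[ℂ] MvPowerSeries τ ℂ)
    (hi : Function.Injective i) (hj : Function.Injective j) :
    Function.Injective (split i j) := by
  classical
  rw [injective_iff_map_eq_zero]
  intro t ht
  let c := Module.Basis.ofVectorSpace ℂ A
  obtain ⟨w, rfl⟩ := (TensorProduct.equivFinsuppOfBasisLeft (N := B) c).symm.surjective t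
  rw [TensorProduct.equivFinsuppOfBasisLeft_symm_apply] at ht
  have key : ∀ β : τ →₀ ℕ, ∀ k, coeff β (j (w k)) = 0 := by
    intro β k
    have h0 : ∑ k ∈ w.support, coeff β (j (w k)) • c k = 0 := by
      apply hi
      rw [map_sum, map_zero]
      ext α
      have h := congrArg (coeff (α.sumElim β)) ht
      rw [Finsupp.sum, map_sum, map_sum, map_zero] at h
      rw [map_sum, map_zero]
      rw [← h]
      refine Finset.sum_congr rfl fun k _ => ?_
      rw [coeff_split_tmul, map_smul, map_smul, smul_eq_mul, mul_comm]
    by_cases hk : k ∈ w.support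
    · exact linearIndependent_iff'.1 c.linearIndependent _ _ h0 k hk
    · rw [Finsupp.notMem_support_iff.1 hk, map_zero, map_zero]
  have hw : w = 0 := by
    ext k
    apply hj
    ext β
    rw [key, Finsupp.zero_apply, map_zero, map_zero]
  rw [hw, map_zero]

theorem split_comp_map (i : A →ₐ[ℂ] MvPowerSeries σ ℂ) (j : B →ₐ[ℂ] MvPowerSeries τ ℂ)
    (p : A' →ₐ[ℂ] A) (q : B' →ₐ[ℂ] B) :
    (split i j).comp (Algebra.TensorProduct.map p q) = split (i.comp p) (j.comp q) := by
  ext x <;> simp [split]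

theorem split_renameEquiv {σ' τ' : Type*} (i : A →ₐ[ℂ] MvPowerSeries σ ℂ)
    (j : B →ₐ[ℂ] MvPowerSeries τ ℂ) (e : σ ≃ σ') (e' : τ ≃ τ') :
    split ((renameEquiv ℂ e).toAlgHom.comp i) ((renameEquiv ℂ e').toAlgHom.comp j) =
      (renameEquiv ℂ (Equiv.sumCongr e e')).toAlgHom.comp (split i j) := by
  ext x
  · simp [split]; rfl
  · simp [split]; rfl

end Split

theorem mem_Sym {g : MvPowerSeries ℕ ℂ}
    (h : ∀ (σ : Equiv.Perm ℕ) (m : ℕ →₀ ℕ), coeff (m.embDomain σ.toEmbedding) g = coeff m g)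
    (d : ℕ) (hd : ∀ m : ℕ →₀ ℕ, d < m.degree → coeff m g = 0) : g ∈ Sym := by
  refine ⟨fun σ => ?_, d, hd⟩
  ext m
  rw [coeff_renameEquiv, h]

theorem degree_embDomain {σ τ : Type*} (e : σ ↪ τ) (m : σ →₀ ℕ) :
    (m.embDomain e).degree = m.degree := by
  rw [Finsupp.embDomain_eq_mapDomain, Finsupp.degree_mapDomain]

/-- An identification of `ℕ` with two disjoint copies of `ℕ`. -/
def twoAlphabets : ℕ ≃ ℕ ⊕ ℕ := Equiv.natSumNatEquivNat.symm

theorem coeff_two {f : MvPowerSeries ℕ ℂ} (hf : f ∈ Sym) (σ τ : Equiv.Perm ℕ) (α β : ℕ →₀ ℕ) :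
    coeff ((α.embDomain σ.toEmbedding).sumElim (β.embDomain τ.toEmbedding))
      (renameEquiv ℂ twoAlphabets f) = coeff (α.sumElim β) (renameEquiv ℂ twoAlphabets f) := by
  conv_rhs => rw [← coeff_embDomain_renameEquiv (Equiv.sumCongr σ τ)]
  have h1 : renameEquiv ℂ (Equiv.sumCongr σ τ) (renameEquiv ℂ twoAlphabets f) =
      renameEquiv ℂ twoAlphabets f := by
    rw [← AlgEquiv.trans_apply, renameEquiv_trans]
    exact renameEquiv_eq _ _ hf
  rw [h1]
  congr 2
  refine Finsupp.ext (M := ℕ) fun x => ?_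
  rcases x with x | x
  · obtain ⟨y, rfl⟩ := σ.surjective x
    exact (Finsupp.embDomain_apply_self σ.toEmbedding α y).trans
      (Finsupp.embDomain_apply_self (Equiv.sumCongr σ τ).toEmbedding (α.sumElim β)
        (Sum.inl y)).symm
  · obtain ⟨y, rfl⟩ := τ.surjective x
    exact (Finsupp.embDomain_apply_self τ.toEmbedding β y).trans
      (Finsupp.embDomain_apply_self (Equiv.sumCongr σ τ).toEmbedding (α.sumElim β)
        (Sum.inr y)).symm

theorem degree_sumElim {σ τ : Type*} (α : σ →₀ ℕ) (β : τ →₀ ℕ) :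
    (α.sumElim β).degree = α.degree + β.degree := by
  rw [Finsupp.sumElim_eq_add, map_add, Finsupp.degree_mapDomain, Finsupp.degree_mapDomain]

/-- `f(x, y)` lies in the image of `Sym ⊗ Sym` for every symmetric function `f`. -/
theorem mem_range_split {f : MvPowerSeries ℕ ℂ} (hf : f ∈ Sym) :
    renameEquiv ℂ twoAlphabets f ∈ (split Sym.val Sym.val).range := by
  classical
  obtain ⟨d, hd⟩ := hf.2
  have hF : ∀ m : ℕ ⊕ ℕ →₀ ℕ, d < m.degree → coeff m (renameEquiv ℂ twoAlphabets f) = 0 := by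
    intro m hm
    rw [coeff_renameEquiv]
    exact hd _ (by rwa [degree_embDomain])
  set F := renameEquiv ℂ twoAlphabets f with hFdef
  have hid : ∀ m : ℕ →₀ ℕ, m.embDomain (Equiv.refl ℕ).toEmbedding = m := fun m =>
    Finsupp.ext fun x => Finsupp.embDomain_apply_self (Equiv.refl ℕ).toEmbedding m x
  let part : (ℕ →₀ ℕ) → Sym := fun α => ⟨fun β => coeff (α.sumElim β) F, by
    refine mem_Sym (fun σ β => ?_) d fun β hβ => hF _ (by rw [degree_sumElim]; omega)
    have := coeff_two hf (Equiv.refl ℕ) σ α β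
    rwa [hid] at this⟩
  have hpart : ∀ α β, coeff β (part α).1 = coeff (α.sumElim β) F := fun _ _ => rfl
  have hinv : ∀ (σ : Equiv.Perm ℕ) α, part (α.embDomain σ.toEmbedding) = part α := by
    intro σ α
    refine Subtype.ext (MvPowerSeries.ext fun β => ?_)
    rw [hpart, hpart]
    have := coeff_two hf σ (Equiv.refl ℕ) α β
    rwa [hid] at this
  have hfin : (part '' {α | α.degree ≤ d}).Finite := by
    refine Set.Finite.subset (Set.Finite.image part
      (Set.finite_Iic (∑ i ∈ Finset.range d, Finsupp.single i d))) ?_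
    rintro _ ⟨α, hα, rfl⟩
    have hcard : α.support.card ≤ d := by
      refine le_trans ?_ hα
      rw [Finsupp.degree_apply, Finset.card_eq_sum_ones]
      exact Finset.sum_le_sum fun x hx => Nat.one_le_iff_ne_zero.2 (Finsupp.mem_support_iff.1 hx)
    obtain ⟨g, hg, hinj⟩ : ∃ g : ℕ → ℕ, (∀ x ∈ α.support, g x < d) ∧
        Set.InjOn g α.support := by
      refine ⟨fun x => if h : x ∈ α.support then (α.support.equivFin ⟨x, h⟩).1 else 0,
        fun x hx => ?_, fun x hx y hy hxy => ?_⟩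
      · simp only [dif_pos hx]
        exact lt_of_lt_of_le (Fin.is_lt _) hcard
      · simp only [dif_pos (Finset.mem_coe.1 hx), dif_pos (Finset.mem_coe.1 hy)] at hxy
        exact congrArg Subtype.val (α.support.equivFin.injective (Fin.ext hxy))
    obtain ⟨σ, hσ⟩ := exists_perm α.support g hinj
    refine ⟨α.embDomain σ.toEmbedding, ?_, hinv σ α⟩
    intro x
    obtain ⟨y, rfl⟩ := σ.surjective x
    rw [show (α.embDomain σ.toEmbedding) (σ y) = α y from
      Finsupp.embDomain_apply_self σ.toEmbedding α y]
    by_cases hy : y ∈ α.support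
    · have h1 : σ y < d := by rw [hσ y hy]; exact hg y hy
      have h2 : α y ≤ d := (Finsupp.le_degree y α).trans hα
      rw [Finsupp.finsetSum_apply, Finset.sum_eq_single_of_mem (σ y) (Finset.mem_range.2 h1)
        (fun i _ hi => Finsupp.single_eq_of_ne (Ne.symm hi)), Finsupp.single_eq_same]
      exact h2
    · rw [Finsupp.notMem_support_iff.1 hy]
      exact Nat.zero_le _
  let ind : Sym → Sym := fun g => ⟨fun α => if α.degree ≤ d ∧ part α = g then 1 else 0, by
    refine mem_Sym (fun σ α => ?_) d fun α hα => if_neg fun h => absurd h.1 (by omega)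
    change (if _ then (1 : ℂ) else 0) = if _ then 1 else 0
    rw [degree_embDomain, hinv]⟩
  have hind : ∀ g α, coeff α (ind g).1 = if α.degree ≤ d ∧ part α = g then 1 else 0 :=
    fun _ _ => rfl
  refine ⟨∑ g ∈ hfin.toFinset, ind g ⊗ₜ[ℂ] g, ?_⟩
  change split Sym.val Sym.val _ = F
  ext m
  obtain ⟨α, β, rfl⟩ : ∃ (α β : ℕ →₀ ℕ), m = α.sumElim β :=
    ⟨_, _, (Finsupp.comapDomain_sumElim_comapDomain m).symm⟩
  rw [map_sum, map_sum]
  simp only [coeff_split_tmul, Subalgebra.coe_val, hind]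
  by_cases hα : α.degree ≤ d
  · rw [Finset.sum_eq_single (part α)]
    · rw [if_pos ⟨hα, rfl⟩, one_mul, hpart]
    · intro g _ hg
      rw [if_neg fun h => hg h.2.symm, zero_mul]
    · intro h
      exact absurd (hfin.mem_toFinset.2 ⟨α, hα, rfl⟩) h
  · rw [hF _ (by rw [degree_sumElim]; omega)]
    exact Finset.sum_eq_zero fun g _ => by rw [if_neg fun h => hα h.1, zero_mul]

theorem val_injective : Function.Injective Sym.val := Subtype.val_injective

/-- The comultiplication of `Sym`: `Δ f` is the unique element of `Sym ⊗ Sym` which represents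
`f(x, y) = f(x₀, x₁, …, y₀, y₁, …)`, the function `f` evaluated at the union of two disjoint
alphabets. -/
def comul : Sym →ₐ[ℂ] Sym ⊗[ℂ] Sym :=
  (AlgEquiv.ofInjective (split Sym.val Sym.val)
      (split_injective _ _ val_injective val_injective)).symm.toAlgHom.comp
    (((renameEquiv ℂ twoAlphabets).toAlgHom.comp Sym.val).codRestrict
      (split Sym.val Sym.val).range fun f => mem_range_split f.2)

theorem split_comul (f : Sym) :
    split Sym.val Sym.val (comul f) = renameEquiv ℂ twoAlphabets f.1 :=
  congrArg Subtype.val ((AlgEquiv.ofInjective (split Sym.val Sym.val)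
      (split_injective _ _ val_injective val_injective)).apply_symm_apply
    ⟨renameEquiv ℂ twoAlphabets f.1, mem_range_split f.2⟩)

theorem split_comp_comul : (split Sym.val Sym.val).comp comul =
    (renameEquiv ℂ twoAlphabets).toAlgHom.comp Sym.val := AlgHom.ext split_comul

/-- The counit of `Sym`: the constant coefficient, that is, evaluation at `x = 0`. -/
def counit : Sym →ₐ[ℂ] ℂ where
  toFun f := constantCoeff f.1
  map_one' := map_one _
  map_mul' f g := map_mul _ f.1 g.1
  map_zero' := map_zero _
  map_add' f g := map_add _ f.1 g.1
  commutes' r := by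
    change constantCoeff (algebraMap ℂ (MvPowerSeries ℕ ℂ) r) = r
    rw [MvPowerSeries.algebraMap_apply]; simp

theorem split_assoc : (split Sym.val (split Sym.val Sym.val)).comp
      (Algebra.TensorProduct.assoc ℂ ℂ ℂ Sym Sym Sym).toAlgHom =
    (renameEquiv ℂ (Equiv.sumAssoc ℕ ℕ ℕ)).toAlgHom.comp
      (split (split Sym.val Sym.val) Sym.val) := by
  refine AlgHom.toLinearMap_injective (TensorProduct.ext_threefold fun a b c => ?_)
  change split Sym.val (split Sym.val Sym.val) (a ⊗ₜ (b ⊗ₜ c)) =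
    rename (Equiv.sumAssoc ℕ ℕ ℕ) (split (split Sym.val Sym.val) Sym.val ((a ⊗ₜ b) ⊗ₜ c))
  simp only [split_tmul, map_mul, rename_rename, mul_assoc]
  rfl

theorem coassoc : (Algebra.TensorProduct.assoc ℂ ℂ ℂ Sym Sym Sym).toAlgHom.comp
      ((Algebra.TensorProduct.map comul (.id ℂ Sym)).comp comul) =
    (Algebra.TensorProduct.map (.id ℂ Sym) comul).comp comul := by
  refine AlgHom.ext fun f => split_injective Sym.val (split Sym.val Sym.val) val_injective
    (split_injective _ _ val_injective val_injective) ?_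
  have hL : (split Sym.val (split Sym.val Sym.val)).comp
      ((Algebra.TensorProduct.assoc ℂ ℂ ℂ Sym Sym Sym).toAlgHom.comp
        ((Algebra.TensorProduct.map comul (.id ℂ Sym)).comp comul)) =
      (renameEquiv ℂ (Equiv.sumAssoc ℕ ℕ ℕ)).toAlgHom.comp
        ((renameEquiv ℂ (Equiv.sumCongr twoAlphabets (Equiv.refl ℕ))).toAlgHom.comp
          ((renameEquiv ℂ twoAlphabets).toAlgHom.comp Sym.val)) := by
    rw [← AlgHom.comp_assoc, split_assoc, AlgHom.comp_assoc, ← AlgHom.comp_assoc _ _ comul,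
      split_comp_map, split_comp_comul, AlgHom.comp_id,
      show split ((renameEquiv ℂ twoAlphabets).toAlgHom.comp Sym.val) Sym.val =
        (renameEquiv ℂ (Equiv.sumCongr twoAlphabets (Equiv.refl ℕ))).toAlgHom.comp
          (split Sym.val Sym.val) from by
        rw [← split_renameEquiv, renameEquiv_refl]; rfl,
      AlgHom.comp_assoc, split_comp_comul]
  have hR : (split Sym.val (split Sym.val Sym.val)).comp
      ((Algebra.TensorProduct.map (.id ℂ Sym) comul).comp comul) =
      (renameEquiv ℂ (Equiv.sumCongr (Equiv.refl ℕ) twoAlphabets)).toAlgHom.comp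
          ((renameEquiv ℂ twoAlphabets).toAlgHom.comp Sym.val) := by
    rw [← AlgHom.comp_assoc, split_comp_map, split_comp_comul, AlgHom.comp_id,
      show split Sym.val ((renameEquiv ℂ twoAlphabets).toAlgHom.comp Sym.val) =
        (renameEquiv ℂ (Equiv.sumCongr (Equiv.refl ℕ) twoAlphabets)).toAlgHom.comp
          (split Sym.val Sym.val) from by
        rw [← split_renameEquiv, renameEquiv_refl]; rfl,
      AlgHom.comp_assoc, split_comp_comul]
  refine (DFunLike.congr_fun hL f).trans (Eq.trans ?_ (DFunLike.congr_fun hR f).symm)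
  change renameEquiv ℂ _ (renameEquiv ℂ _ (renameEquiv ℂ _ f.1)) =
    renameEquiv ℂ _ (renameEquiv ℂ _ f.1)
  simp only [← AlgEquiv.trans_apply, renameEquiv_trans]
  exact renameEquiv_eq _ _ f.2

theorem killCompl_inr : (killCompl (R := ℂ) (Function.Embedding.inr : ℕ ↪ ℕ ⊕ ℕ)).comp
      (split Sym.val Sym.val) =
    Sym.val.comp ((Algebra.TensorProduct.lid ℂ Sym).toAlgHom.comp
      (Algebra.TensorProduct.map counit (.id ℂ Sym))) := by
  refine Algebra.TensorProduct.ext' fun a b => ?_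
  change killCompl _ (split Sym.val Sym.val (a ⊗ₜ b)) = (counit a • b : Sym).1
  ext m
  rw [coeff_killCompl, Finsupp.embDomain_inr, coeff_split_tmul]
  exact (map_smul (coeff m) (counit a) b.1).symm

theorem killCompl_inl : (killCompl (R := ℂ) (Function.Embedding.inl : ℕ ↪ ℕ ⊕ ℕ)).comp
      (split Sym.val Sym.val) =
    Sym.val.comp ((Algebra.TensorProduct.rid ℂ ℂ Sym).toAlgHom.comp
      (Algebra.TensorProduct.map (.id ℂ Sym) counit)) := by
  refine Algebra.TensorProduct.ext' fun a b => ?_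
  change killCompl _ (split Sym.val Sym.val (a ⊗ₜ b)) = (counit b • a : Sym).1
  ext m
  rw [coeff_killCompl, Finsupp.embDomain_inl, coeff_split_tmul, mul_comm]
  exact (map_smul (coeff m) (counit b) a.1).symm

theorem coeff_renameEquiv_embDomain (g : ℕ ↪ ℕ ⊕ ℕ) {f : MvPowerSeries ℕ ℂ} (hf : f ∈ Sym)
    (m : ℕ →₀ ℕ) : coeff (m.embDomain g) (renameEquiv ℂ twoAlphabets f) = coeff m f := by
  rw [coeff_renameEquiv]
  refine Eq.trans ?_ (coeff_embDomain hf (g.trans twoAlphabets.symm.toEmbedding) m)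
  congr 2
  rw [Finsupp.embDomain_eq_mapDomain, Finsupp.embDomain_eq_mapDomain,
    Finsupp.embDomain_eq_mapDomain, ← Finsupp.mapDomain_comp]
  rfl

theorem rTensor_counit : (Algebra.TensorProduct.map counit (.id ℂ Sym)).comp comul =
    (Algebra.TensorProduct.lid ℂ Sym).symm := by
  refine AlgHom.ext fun f => (Algebra.TensorProduct.lid ℂ Sym).injective (val_injective ?_)
  refine (DFunLike.congr_fun killCompl_inr (comul f)).symm.trans ?_
  change killCompl _ (split Sym.val Sym.val (comul f)) =
    Sym.val (Algebra.TensorProduct.lid ℂ Sym ((Algebra.TensorProduct.lid ℂ Sym).symm f))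
  rw [split_comul, AlgEquiv.apply_symm_apply]
  ext m
  rw [coeff_killCompl]
  exact coeff_renameEquiv_embDomain _ f.2 m

theorem lTensor_counit : (Algebra.TensorProduct.map (.id ℂ Sym) counit).comp comul =
    (Algebra.TensorProduct.rid ℂ ℂ Sym).symm := by
  refine AlgHom.ext fun f => (Algebra.TensorProduct.rid ℂ ℂ Sym).injective (val_injective ?_)
  refine (DFunLike.congr_fun killCompl_inl (comul f)).symm.trans ?_
  change killCompl _ (split Sym.val Sym.val (comul f)) =
    Sym.val (Algebra.TensorProduct.rid ℂ ℂ Sym ((Algebra.TensorProduct.rid ℂ ℂ Sym).symm f))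
  rw [split_comul, AlgEquiv.apply_symm_apply]
  ext m
  rw [coeff_killCompl]
  exact coeff_renameEquiv_embDomain _ f.2 m

/-- The bialgebra structure of `Sym`. -/
instance : Bialgebra ℂ Sym :=
  Bialgebra.ofAlgHom comul counit coassoc rTensor_counit lTensor_counit

/-- The complete homogeneous symmetric function `h_n`: the sum of all monomials of degree `n` in
the variables `x₀, x₁, x₂, …`. -/
def hsymm (n : ℕ) : Sym :=
  ⟨fun m => if m.degree = n then 1 else 0, by
    refine mem_Sym (fun σ m => ?_) n fun m hm => if_neg (by omega)
    change (if _ then (1 : ℂ) else 0) = if _ then 1 else 0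
    rw [degree_embDomain]⟩

/-- The group `X(Sym)` of characters of `Sym`, that is, of unital multiplicative linear maps
`Sym → ℂ`. Its multiplication (Mathlib's instance on `WithConv`) is the convolution
`η₁ η₂ = (η₁ ⊗ η₂) ∘ Δ`. -/
abbrev Character : Type := WithConv (Sym →ₐ[ℂ] ℂ)

end SymFun

/-! ## Distributions, free independence and free multiplicative convolution -/

namespace FreeProb

/-- `D_alg(1)`: the linear functionals `μ` on `ℂ⟨X⟩ = ℂ[X]` with `μ(1) = 1`. -/
abbrev Distribution : Type := {μ : ℂ[X] →ₗ[ℂ] ℂ // μ 1 = 1}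

instance : Nonempty Distribution :=
  ⟨(Polynomial.aeval (1 : ℂ)).toLinearMap, map_one (Polynomial.aeval (1 : ℂ))⟩

/-- `a` has distribution `μ` in the noncommutative probability space `(A, φ)`: `φ(aⁿ) = μ(Xⁿ)` for
all `n`. -/
def HasDistribution {A : Type*} [Ring A] [Algebra ℂ A] (φ : A →ₗ[ℂ] ℂ) (a : A)
    (μ : Distribution) : Prop :=
  ∀ n : ℕ, φ (a ^ n) = μ.1 (Polynomial.X ^ n)

/-- Free independence of a family of unital subalgebras: `φ(c₁ c₂ ⋯ cₙ) = 0` for all `n ≥ 1`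
whenever `c_j ∈ B(i_j)`, `φ(c_j) = 0` for all `j`, and `i_j ≠ i_{j+1}` for all `j < n`. The list `l`
consists of the pairs `(i_j, c_j)`. -/
def FreelyIndependent {A : Type*} [Ring A] [Algebra ℂ A] (φ : A →ₗ[ℂ] ℂ) {ι : Type*}
    (B : ι → Subalgebra ℂ A) : Prop :=
  ∀ l : List (ι × A), l ≠ [] → (∀ p ∈ l, p.2 ∈ B p.1 ∧ φ p.2 = 0) →
    l.IsChain (fun p q => p.1 ≠ q.1) → φ (l.map Prod.snd).prod = 0

/-- Free independence of a family of subsets: free independence of the unital subalgebras which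
they generate. -/
def FreelyIndependentSets {A : Type*} [Ring A] [Algebra ℂ A] (φ : A →ₗ[ℂ] ℂ) {ι : Type*}
    (s : ι → Set A) : Prop :=
  FreelyIndependent φ fun i => Algebra.adjoin ℂ (s i)

/-- `ρ` is the distribution of `ab` for some elements `a, b` of a noncommutative probability space
`(A, φ)` such that `a` has distribution `μ`, `b` has distribution `ν`, and `{a}` is freely
independent from `{b}`. -/
def IsFreeProductDistribution (μ ν ρ : Distribution) : Prop :=
  ∃ (A : Type u) (_ : Ring A) (_ : Algebra ℂ A) (φ : A →ₗ[ℂ] ℂ) (a b : A), φ 1 = 1 ∧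
    HasDistribution φ a μ ∧ HasDistribution φ b ν ∧
    FreelyIndependentSets φ ![{a}, {b}] ∧ HasDistribution φ (a * b) ρ

/-- The free multiplicative convolution `μ ⊠ ν`: the distribution of `ab`, where `a` and `b` are
freely independent with distributions `μ` and `ν`. -/
def freeMulConv (μ ν : Distribution) : Distribution :=
  Classical.epsilon fun ρ => IsFreeProductDistribution.{0} μ ν ρ

/-- `G₁`: the distributions `μ ∈ D_alg(1)` with `μ(X) = 1`. -/
def G₁ : Set Distribution := {μ | μ.1 Polynomial.X = 1}

/-- The moment series `M_μ(z) = ∑_{n ≥ 1} μ(Xⁿ) zⁿ`. -/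
def momentSeries (μ : Distribution) : PowerSeries ℂ :=
  PowerSeries.mk fun n => if n = 0 then 0 else μ.1 (Polynomial.X ^ n)

theorem isUnit_coeff_one_momentSeries (μ : G₁) :
    IsUnit (PowerSeries.coeff 1 (momentSeries μ.1)) := by
  have h : μ.1.1 Polynomial.X = 1 := μ.2
  simp [momentSeries, h]

/-- The `S`-transform `S_μ(z) = ((1 + z) / z) · M_μ^{⟨-1⟩}(z)` of `μ ∈ G₁`, where `M_μ^{⟨-1⟩}` is
the inverse of `M_μ` under composition. Dividing by `z` a series without constant term shifts its
coefficients. -/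
def sTransform (μ : G₁) : PowerSeries ℂ :=
  PowerSeries.mk fun n => PowerSeries.coeff (n + 1) ((1 + PowerSeries.X) *
    (momentSeries μ.1).substInvOfIsUnit (isUnit_coeff_one_momentSeries μ))

end FreeProb

end

universe v

noncomputable section

/-! ## Power series in a locally nilpotent operator -/

section LocallyNilpotent

variable {V W : Type*} [AddCommGroup V] [Module ℂ V] [AddCommGroup W] [Module ℂ W]

/-! The proof runs through Haagerup's Fock space model of the `S`-transform. Let `∂` be the backward
shift on `ℂ[X]`, let `f` be a power series with `f(0) = 1`, and consider the operator `a = (1 + X)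
f(∂)` under the state `p ↦ p(0)`. A recursion for the series `∑ₙ (aᵏ Xⁿ)(0) zⁿ` telescopes to `M(z /
((1 + z) f(z))) = z` (`momentSeries_subst_modelInv`), so the distribution of `a` has `S`-transform
`1 / f`. Since `S_μ` determines `μ`, every `μ ∈ G₁` is realized in this way, with `f = 1 / S_μ`.

On the full Fock space with creation operators `lᵢ`, the operator `(1 + lᵢ) f(lᵢ*)` has the same
distribution in the vacuum state. Operators attached to distinct letters are free
(`freelyIndependentSets_fockOp`), and the product of those of `f` and `g` is distributed like the
one-letter model of `f g` (`hasDistribution_fockOp_mul`). This gives existence of `μ ⊠ ν`.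
Uniqueness holds because freeness determines the moments of `ab` (`state_mul_pow_eq`). Hence `S_{μ ⊠
ν} = S_μ S_ν`, and `S` identifies `(G₁, ⊠)` with the multiplicative group of power series with
constant term `1`.

The character group is the same group. `Sym` is the polynomial ring in `e₁, e₂, …`
(`esymmHom_injective`, `esymmHom_surjective`) and `E(-z) H(z) = 1`, so a character `χ` amounts to an
arbitrary series `∑ χ(hₙ) zⁿ` with constant term `1`. The formula `Δ hₙ = ∑ hᵢ ⊗ hₙ₋ᵢ` turns
convolution into multiplication of series. The automorphism `z ↦ -z` accounts for the signs `(-1)ⁿ`.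
-/

theorem aeval_apply_eq_of_pow_apply_eq_zero {D : Module.End ℂ V} {p q : ℂ[X]} {N : ℕ} {v : V}
    (hpq : ∀ k < N, p.coeff k = q.coeff k) (hv : (D ^ N) v = 0) :
    Polynomial.aeval D p v = Polynomial.aeval D q v := by
  obtain ⟨r, hr⟩ : Polynomial.X ^ N ∣ p - q :=
    Polynomial.X_pow_dvd_iff.2 fun k hk => by rw [Polynomial.coeff_sub, hpq k hk, sub_self]
  have h : Polynomial.aeval D (p - q) v = 0 := by
    rw [hr, mul_comm, map_mul, map_pow, Polynomial.aeval_X, Module.End.mul_apply, hv, map_zero]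
  rwa [map_sub, LinearMap.sub_apply, sub_eq_zero] at h

theorem aeval_intertwine {D : Module.End ℂ W} {d : Module.End ℂ V} {J : V →ₗ[ℂ] W}
    (h : ∀ v, D (J v) = J (d v)) (p : ℂ[X]) (v : V) :
    Polynomial.aeval D p (J v) = J (Polynomial.aeval d p v) := by
  have hpow : ∀ (n : ℕ) (v : V), (D ^ n) (J v) = J ((d ^ n) v) := by
    intro n
    induction n with
    | zero => intro v; rfl
    | succ n ih => intro v; rw [pow_succ, Module.End.mul_apply, h, ih, pow_succ,
        Module.End.mul_apply]
  induction p using Polynomial.induction_on' with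
  | add p q hp hq => simp only [map_add, LinearMap.add_apply, hp, hq]
  | monomial n a => simp [Polynomial.aeval_monomial, Algebra.algebraMap_eq_smul_one, hpow]

/-- Every vector is annihilated by some power of `D`. -/
def LocallyNilpotent (D : Module.End ℂ V) : Prop := ∀ v, ∃ n, (D ^ n) v = 0

theorem pow_apply_eq_zero_of_le {D : Module.End ℂ V} {m n : ℕ} {v : V} (hmn : m ≤ n)
    (h : (D ^ m) v = 0) : (D ^ n) v = 0 := by
  rw [← Nat.sub_add_cancel hmn, pow_add, Module.End.mul_apply, h, map_zero]

/-- Makes the truncation order irrelevant once it is large enough, so that the arbitrary choice made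
in `seriesEval` does no harm. -/
theorem trunc_aeval_eq {D : Module.End ℂ V} (f : PowerSeries ℂ) {m n : ℕ} {v : V}
    (hm : (D ^ m) v = 0) (hn : (D ^ n) v = 0) :
    Polynomial.aeval D (PowerSeries.trunc m f) v =
      Polynomial.aeval D (PowerSeries.trunc n f) v := by
  wlog hmn : m ≤ n generalizing m n
  · exact (this hn hm (le_of_not_ge hmn)).symm
  · refine aeval_apply_eq_of_pow_apply_eq_zero (N := m) (fun k hk => ?_) hm
    rw [PowerSeries.coeff_trunc, PowerSeries.coeff_trunc, if_pos hk, if_pos (hk.trans_le hmn)]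

/-- The operator `f(D) = ∑ fₖ Dᵏ` for a power series `f` and a locally nilpotent operator `D`. -/
def seriesEval {D : Module.End ℂ V} (hD : LocallyNilpotent D) (f : PowerSeries ℂ) :
    Module.End ℂ V where
  toFun v := Polynomial.aeval D (PowerSeries.trunc (hD v).choose f) v
  map_add' v w := by
    -- The three vectors `v`, `w`, `v + w` come with unrelated truncation orders; a common bound
    -- lets all three be computed with the same polynomial.
    obtain ⟨n, hn⟩ := (⟨_, le_max_left _ _, le_max_right _ _⟩ :
      ∃ n, (hD v).choose ≤ n ∧ (hD w).choose ≤ n)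
    have hv := pow_apply_eq_zero_of_le hn.1 (hD v).choose_spec
    have hw := pow_apply_eq_zero_of_le hn.2 (hD w).choose_spec
    rw [trunc_aeval_eq f (hD (v + w)).choose_spec (n := n) (by rw [map_add, hv, hw, add_zero]),
      map_add, trunc_aeval_eq f (hD v).choose_spec hv, trunc_aeval_eq f (hD w).choose_spec hw]
  map_smul' c v := by
    rw [trunc_aeval_eq f (hD (c • v)).choose_spec (n := (hD v).choose)
      (by rw [map_smul, (hD v).choose_spec, smul_zero]), map_smul]
    rfl

variable {D : Module.End ℂ W} {d : Module.End ℂ V} (hD : LocallyNilpotent D)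
  (hd : LocallyNilpotent d)

theorem seriesEval_apply {f : PowerSeries ℂ} {p : ℂ[X]} {N : ℕ} {v : V}
    (hp : ∀ k < N, p.coeff k = PowerSeries.coeff k f) (hv : (d ^ N) v = 0) :
    seriesEval hd f v = Polynomial.aeval d p v := by
  refine (trunc_aeval_eq f (hd v).choose_spec hv).trans
    (aeval_apply_eq_of_pow_apply_eq_zero (N := N) (fun k hk => ?_) hv)
  rw [PowerSeries.coeff_trunc, if_pos hk, hp k hk]

theorem seriesEval_apply_trunc (f : PowerSeries ℂ) {N : ℕ} {v : V} (hv : (d ^ N) v = 0) :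
    seriesEval hd f v = Polynomial.aeval d (PowerSeries.trunc N f) v :=
  seriesEval_apply hd (fun k hk => by rw [PowerSeries.coeff_trunc, if_pos hk]) hv

/-- The transport principle behind all Fock space computations: where an annihilation operator acts
as the backward shift, `f(lᵢ*)` acts as `f(∂)`. -/
theorem seriesEval_intertwine {J : V →ₗ[ℂ] W} (h : ∀ v, D (J v) = J (d v)) (f : PowerSeries ℂ)
    (v : V) : seriesEval hD f (J v) = J (seriesEval hd f v) := by
  obtain ⟨n, hn⟩ := hd v
  have hn' : (D ^ n) (J v) = 0 := by
    have := aeval_intertwine h (Polynomial.X ^ n) v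
    rwa [map_pow, map_pow, Polynomial.aeval_X, Polynomial.aeval_X, hn, map_zero] at this
  rw [seriesEval_apply_trunc hD f hn', seriesEval_apply_trunc hd f hn, aeval_intertwine h]

theorem seriesEval_mul (f g : PowerSeries ℂ) (v : V) :
    seriesEval hd (f * g) v = seriesEval hd f (seriesEval hd g v) := by
  obtain ⟨n, hn⟩ := hd v
  -- `d` intertwines itself with itself, hence commutes with `g(d)`; so the power of `d` that kills
  -- `v` also kills `g(d) v`, and one truncation order serves both factors.
  have hcomm : ∀ w, d (seriesEval hd g w) = seriesEval hd g (d w) := fun w =>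
    (seriesEval_intertwine hd hd (J := d) (fun _ => rfl) g w).symm
  have hn' : (d ^ n) (seriesEval hd g v) = 0 := by
    have := aeval_intertwine (J := seriesEval hd g) hcomm (Polynomial.X ^ n) v
    rwa [map_pow, Polynomial.aeval_X, hn, map_zero] at this
  rw [seriesEval_apply_trunc hd f hn', seriesEval_apply_trunc hd g hn, ← Module.End.mul_apply,
    ← map_mul]
  refine seriesEval_apply hd (N := n) (fun k hk => ?_) hn
  rw [Polynomial.coeff_mul, PowerSeries.coeff_mul]
  refine Finset.sum_congr rfl fun x hx => ?_
  have := Finset.HasAntidiagonal.mem_antidiagonal.1 hx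
  rw [PowerSeries.coeff_trunc, PowerSeries.coeff_trunc, if_pos (by omega), if_pos (by omega)]

end LocallyNilpotent

/-! ## The one-variable model -/

namespace FreeProb

/-- The backward shift of `ℂ[X]`. -/
def divXHom : Module.End ℂ ℂ[X] where
  toFun := Polynomial.divX
  map_add' _ _ := Polynomial.divX_add
  map_smul' c p := by ext n; simp [Polynomial.coeff_divX]

@[simp] theorem divXHom_one : divXHom 1 = 0 := Polynomial.divX_one

@[simp] theorem divXHom_X_pow_succ (n : ℕ) :
    divXHom (Polynomial.X ^ (n + 1)) = Polynomial.X ^ n := by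
  change Polynomial.divX _ = _
  rw [Polynomial.divX_X_pow, if_neg n.succ_ne_zero, Nat.add_sub_cancel]

theorem divXHom_pow_X_pow (k n : ℕ) :
    (divXHom ^ k) (Polynomial.X ^ n) = if k ≤ n then Polynomial.X ^ (n - k) else 0 := by
  induction k generalizing n with
  | zero => simp
  | succ k ih =>
    rw [pow_succ, Module.End.mul_apply]
    cases n with
    | zero => simp
    | succ n => rw [divXHom_X_pow_succ, ih]; simp

theorem coeff_divXHom_pow (k n : ℕ) (p : ℂ[X]) : ((divXHom ^ k) p).coeff n = p.coeff (n + k) := by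
  induction k generalizing p with
  | zero => rfl
  | succ k ih =>
    rw [pow_succ, Module.End.mul_apply, ih]
    exact Polynomial.coeff_divX

theorem locallyNilpotent_divXHom : LocallyNilpotent divXHom := fun p =>
  ⟨p.natDegree + 1, Polynomial.ext fun n => by
    rw [coeff_divXHom_pow, Polynomial.coeff_eq_zero_of_natDegree_lt (by omega),
      Polynomial.coeff_zero]⟩

theorem seriesEval_divXHom_X_pow (f : PowerSeries ℂ) (n : ℕ) :
    seriesEval locallyNilpotent_divXHom f (Polynomial.X ^ n) =
      ∑ k ∈ Finset.range (n + 1), PowerSeries.coeff k f • Polynomial.X ^ (n - k) := by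
  rw [seriesEval_apply _ (N := n + 1) (f := f)
      (p := ∑ k ∈ Finset.range (n + 1), Polynomial.monomial k (PowerSeries.coeff k f))
      (fun k hk => by simp [Polynomial.coeff_monomial, hk])
      (by rw [divXHom_pow_X_pow, if_neg (by omega)]),
    map_sum, LinearMap.sum_apply]
  refine Finset.sum_congr rfl fun k hk => ?_
  have := Finset.mem_range.1 hk
  simp [Polynomial.aeval_monomial, Algebra.algebraMap_eq_smul_one, divXHom_pow_X_pow,
    show k ≤ n by omega]

/-- The operator `(1 + X) f(∂)` on `ℂ[X]`, where `∂` is the backward shift. -/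
def modelOp (f : PowerSeries ℂ) : Module.End ℂ ℂ[X] :=
  (1 + LinearMap.mulLeft ℂ Polynomial.X) * seriesEval locallyNilpotent_divXHom f

theorem modelOp_apply (f : PowerSeries ℂ) (p : ℂ[X]) :
    modelOp f p = (1 + Polynomial.X) * seriesEval locallyNilpotent_divXHom f p := by
  simp [modelOp, add_mul]

/-- The distribution of `(1 + X) f(∂)` with respect to the vacuum state `p ↦ p(0)`. -/
def modelDist (f : PowerSeries ℂ) : Distribution :=
  ⟨{ toFun := fun q => (Polynomial.aeval (modelOp f) q 1).coeff 0
     map_add' := fun p q => by simp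
     map_smul' := fun c p => by simp }, by simp⟩

theorem modelDist_apply (f : PowerSeries ℂ) (q : ℂ[X]) :
    (modelDist f).1 q = (Polynomial.aeval (modelOp f) q 1).coeff 0 := rfl

theorem modelDist_X (f : PowerSeries ℂ) (hf : PowerSeries.constantCoeff f = 1) :
    (modelDist f).1 Polynomial.X = 1 := by
  have h := seriesEval_divXHom_X_pow f 0
  simp only [pow_zero, zero_add, Finset.sum_range_one, PowerSeries.coeff_zero_eq_constantCoeff, hf,
    one_smul, Nat.zero_sub] at h
  rw [modelDist_apply, Polynomial.aeval_X, modelOp_apply, h]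
  simp

/-- The generating series of `n ↦ (aᵏ Xⁿ)(0)` with `a = (1 + X) f(∂)`. -/
def transferSeries (f : PowerSeries ℂ) (k : ℕ) : PowerSeries ℂ :=
  PowerSeries.mk fun n => ((modelOp f ^ k) (Polynomial.X ^ n)).coeff 0

theorem transferSeries_zero (f : PowerSeries ℂ) : transferSeries f 0 = 1 := by
  ext n
  simp [transferSeries, PowerSeries.coeff_one, Polynomial.coeff_X_pow, eq_comm]

/-- Expanding `a Xⁿ = ∑ⱼ fⱼ (X^(n-j) + X^(n-j+1))` exhibits the series for `aᵏ⁺¹` as a Cauchy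
product `f Q`, where `Q` collects the values of `aᵏ` on `Xⁿ + Xⁿ⁺¹`. Multiplying `Q` by the variable
gives `(1 + z) Fₖ` without its constant term, which is the `k`-th moment. -/
theorem X_mul_transferSeries_succ (f : PowerSeries ℂ) (k : ℕ) :
    PowerSeries.X * transferSeries f (k + 1) = f * ((1 + PowerSeries.X) * transferSeries f k -
      PowerSeries.C ((modelDist f).1 (Polynomial.X ^ k))) := by
  set Q : PowerSeries ℂ := PowerSeries.mk fun n =>
    ((modelOp f ^ k) (Polynomial.X ^ n + Polynomial.X ^ (n + 1))).coeff 0 with hQ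
  have h1 : (1 + PowerSeries.X) * transferSeries f k -
      PowerSeries.C ((modelDist f).1 (Polynomial.X ^ k)) = PowerSeries.X * Q := by
    ext n
    cases n with
    | zero => simp [add_mul, transferSeries, modelDist_apply]
    | succ n =>
      simp [add_mul, transferSeries, PowerSeries.coeff_succ_X_mul, hQ, add_comm]
  have h2 : transferSeries f (k + 1) = f * Q := by
    ext n
    rw [PowerSeries.coeff_mul, Finset.Nat.sum_antidiagonal_eq_sum_range_succ_mk]
    simp only [transferSeries, PowerSeries.coeff_mk, hQ]
    rw [pow_succ, Module.End.mul_apply, modelOp_apply, seriesEval_divXHom_X_pow, Finset.mul_sum,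
      map_sum, Polynomial.finsetSum_coeff]
    refine Finset.sum_congr rfl fun j _ => ?_
    rw [mul_smul_comm, map_smul, Polynomial.coeff_smul, smul_eq_mul, add_mul, one_mul,
      pow_succ' _ (n - j)]
  rw [h1, h2]; ring

/-- The compositional inverse of the moment series of `(1 + X) f(∂)`. -/
def modelInv (f : PowerSeries ℂ) : PowerSeries ℂ := PowerSeries.X * ((1 + PowerSeries.X) * f)⁻¹

/-- For `w = z / ((1 + z) f)` the recursion reads `(1 + z) Fₖ = mₖ + w · (1 + z) Fₖ₊₁`. Iterating
from `F₀ = 1` gives `1 + z = ∑ mₖ wᵏ = 1 + M(w)`, where the remainder vanishes because `w` is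
divisible by `z`. -/
theorem momentSeries_subst_modelInv (f : PowerSeries ℂ) (hf : PowerSeries.constantCoeff f = 1) :
    (momentSeries (modelDist f)).subst (modelInv f) = PowerSeries.X := by
  set w := modelInv f with hw
  set m : ℕ → ℂ := fun k => (modelDist f).1 (Polynomial.X ^ k) with hm
  have hu : PowerSeries.constantCoeff ((1 + PowerSeries.X) * f) ≠ 0 := by simp [hf]
  have hinv : ((1 + PowerSeries.X) * f)⁻¹ * ((1 + PowerSeries.X) * f) = 1 :=
    PowerSeries.inv_mul_cancel _ hu
  have hstep : ∀ k, (1 + PowerSeries.X) * transferSeries f k =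
      (1 + PowerSeries.X) * (w * transferSeries f (k + 1)) + PowerSeries.C (m k) := by
    intro k
    have h := X_mul_transferSeries_succ f k
    have : (1 + PowerSeries.X) * (w * transferSeries f (k + 1)) =
        ((1 + PowerSeries.X) * ((1 + PowerSeries.X) * f)⁻¹) *
          (PowerSeries.X * transferSeries f (k + 1)) := by
      rw [hw, modelInv]; ring
    rw [this, h]
    linear_combination -((1 + PowerSeries.X) * transferSeries f k - PowerSeries.C (m k)) * hinv
  have hsum : ∀ N, (1 + PowerSeries.X : PowerSeries ℂ) =
      ∑ k ∈ Finset.range N, m k • w ^ k + (1 + PowerSeries.X) * w ^ N * transferSeries f N := by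
    intro N
    induction N with
    | zero => simp [transferSeries_zero]
    | succ N ih =>
      conv_lhs => rw [ih]
      rw [Finset.sum_range_succ, PowerSeries.smul_eq_C_mul]
      linear_combination w ^ N * hstep N
  have hw0 : PowerSeries.constantCoeff w = 0 := by simp [hw, modelInv]
  have hdvd : ∀ N, PowerSeries.X ^ N ∣ w ^ N := fun N =>
    pow_dvd_pow_of_dvd (PowerSeries.X_dvd_iff.2 hw0) N
  have hlow : ∀ n k, n < k → ∀ g, PowerSeries.coeff n (w ^ k * g) = 0 := fun n k hnk g =>
    PowerSeries.X_pow_dvd_iff.1 ((hdvd k).mul_right g) n hnk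
  ext n
  -- Only `wᵏ` with `k ≤ n` can contribute to the coefficient of `zⁿ`, so the infinite sum may be
  -- compared with the telescoped identity for `N = n + 1`.
  rw [PowerSeries.coeff_subst' (PowerSeries.HasSubst.of_constantCoeff_zero' hw0),
    finsum_eq_sum_of_support_subset (s := Finset.range (n + 1))]
  · have h := congrArg (PowerSeries.coeff n) (hsum (n + 1))
    rw [map_add, map_add, mul_assoc, mul_comm, mul_assoc, hlow n (n + 1) (by omega), add_zero,
      Finset.sum_range_succ', map_add, map_sum, PowerSeries.coeff_one] at h
    rw [Finset.sum_range_succ', momentSeries]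
    simp only [PowerSeries.coeff_mk, Nat.add_one_ne_zero, if_false, if_true, zero_smul, add_zero]
    have hm0 : m 0 = 1 := by simp [hm, (modelDist f).2]
    simp only [hm0, pow_zero, one_smul, PowerSeries.coeff_one, map_smul] at h
    rw [add_comm] at h
    exact (add_right_cancel h).symm
  · intro k hk
    by_contra hkn
    have hkn' : n < k := by simpa using hkn
    refine hk ?_
    have := hlow n k hkn' 1
    rw [mul_one] at this
    simp only [this, smul_zero]

/-! ## The `S`-transform as a coordinate on `G₁` -/

/-- A right compositional inverse equals the two-sided one: apply the inverse of `P` to `P ∘ w = z`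
and use associativity. -/
theorem eq_substInvOfIsUnit {P w : PowerSeries ℂ} (hP : PowerSeries.constantCoeff P = 0)
    (hP' : IsUnit (PowerSeries.coeff 1 P)) (hw : PowerSeries.constantCoeff w = 0)
    (h : P.subst w = PowerSeries.X) : w = P.substInvOfIsUnit hP' := by
  have hPs := PowerSeries.HasSubst.of_constantCoeff_zero' hP
  have hws := PowerSeries.HasSubst.of_constantCoeff_zero' hw
  have h1 := PowerSeries.subst_comp_subst_apply (R := ℂ) hPs hws (P.substInvOfIsUnit hP')
  rw [PowerSeries.subst_substInvOfIsUnit_left P hP hP', h, PowerSeries.subst_X hws] at h1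
  exact h1.trans (PowerSeries.X_subst (P.substInvOfIsUnit hP'))

theorem constantCoeff_momentSeries (μ : Distribution) :
    PowerSeries.constantCoeff (momentSeries μ) = 0 := by
  simp [momentSeries, ← PowerSeries.coeff_zero_eq_constantCoeff_apply]

theorem X_mul_sTransform (μ : G₁) : PowerSeries.X * sTransform μ =
    (1 + PowerSeries.X) *
      (momentSeries μ.1).substInvOfIsUnit (isUnit_coeff_one_momentSeries μ) := by
  ext n
  cases n with
  | zero =>
    simp [PowerSeries.constantCoeff_substInvOfIsUnit]
  | succ n => rw [PowerSeries.coeff_succ_X_mul, sTransform, PowerSeries.coeff_mk]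

theorem constantCoeff_sTransform (μ : G₁) : PowerSeries.constantCoeff (sTransform μ) = 1 := by
  have h : μ.1.1 Polynomial.X = 1 := μ.2
  have h1 := isUnit_coeff_one_momentSeries μ
  have h2 : PowerSeries.coeff 1 (momentSeries μ.1) = 1 := by simp [momentSeries, h]
  have h3 : (h1.unit : ℂ) = 1 := h2
  rw [← PowerSeries.coeff_zero_eq_constantCoeff_apply, sTransform, PowerSeries.coeff_mk, add_mul,
    one_mul, map_add, PowerSeries.coeff_succ_X_mul, PowerSeries.coeff_one_substInvOfIsUnit,
    PowerSeries.coeff_zero_eq_constantCoeff_apply, PowerSeries.constantCoeff_substInvOfIsUnit,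
    add_zero, Units.val_inv_eq_inv_val, h3, inv_one]

theorem distribution_ext {μ ν : Distribution}
    (h : ∀ n, μ.1 (Polynomial.X ^ n) = ν.1 (Polynomial.X ^ n)) : μ = ν :=
  Subtype.ext (Polynomial.lhom_ext' fun n => LinearMap.ext_ring (by
    simpa [Polynomial.monomial_one_right_eq_X_pow] using h n))

/-- Cancelling `1 + z` recovers `M_μ^{⟨-1⟩}` from `S_μ`, hence `M_μ`, hence all moments. -/
theorem sTransform_injective : Function.Injective sTransform := by
  intro μ ν h
  have h1 := X_mul_sTransform μ
  rw [h, X_mul_sTransform ν] at h1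
  have h0 : (1 + PowerSeries.X : PowerSeries ℂ) ≠ 0 := fun h => by
    simpa using congrArg PowerSeries.constantCoeff h
  have h2 := mul_left_cancel₀ h0 h1
  have hM : momentSeries μ.1 = momentSeries ν.1 := by
    set Q := (momentSeries ν.1).substInvOfIsUnit (isUnit_coeff_one_momentSeries ν)
    have hQ : PowerSeries.HasSubst Q := PowerSeries.HasSubst.substInvOfIsUnit _ _
    have hν := constantCoeff_momentSeries ν.1
    have e1 : (momentSeries μ.1).subst Q = PowerSeries.X := by
      rw [h2]
      exact PowerSeries.subst_substInvOfIsUnit_right _ (constantCoeff_momentSeries μ.1) _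
    have e2 := PowerSeries.subst_comp_subst_apply (R := ℂ) hQ
      (PowerSeries.HasSubst.of_constantCoeff_zero' hν) (momentSeries μ.1)
    rw [PowerSeries.subst_substInvOfIsUnit_left _ hν, e1,
      PowerSeries.subst_X (PowerSeries.HasSubst.of_constantCoeff_zero' hν)] at e2
    exact (e2.trans (PowerSeries.X_subst (momentSeries μ.1))).symm
  refine Subtype.ext (distribution_ext fun n => ?_)
  cases n with
  | zero => rw [pow_zero, μ.1.2, ν.1.2]
  | succ n => simpa [momentSeries] using congrArg (PowerSeries.coeff (n + 1)) hM

/-- The inverse of the moment series is `z / ((1 + z) f)`, so the factor `(1 + z) / z` leaves `1 /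
f`. -/
theorem sTransform_modelDist {f : PowerSeries ℂ} (hf : PowerSeries.constantCoeff f = 1) :
    sTransform ⟨modelDist f, modelDist_X f hf⟩ = f⁻¹ := by
  have hX : (PowerSeries.X : PowerSeries ℂ) ≠ 0 := PowerSeries.X_ne_zero
  refine mul_left_cancel₀ hX ?_
  rw [X_mul_sTransform, ← eq_substInvOfIsUnit (constantCoeff_momentSeries _) _
    (by simp [modelInv]) (momentSeries_subst_modelInv f hf), modelInv, PowerSeries.mul_inv_rev]
  have h := PowerSeries.mul_inv_cancel (1 + PowerSeries.X : PowerSeries ℂ) (by simp)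
  linear_combination (PowerSeries.X * f⁻¹) * h

/-- Every `μ ∈ G₁` is the distribution of the model operator of `1 / S_μ`. -/
theorem modelDist_inv_sTransform (μ : G₁) : modelDist (sTransform μ)⁻¹ = μ.1 := by
  have hS := constantCoeff_sTransform μ
  have hf : PowerSeries.constantCoeff (sTransform μ)⁻¹ = 1 := by simp [hS]
  refine congrArg Subtype.val (sTransform_injective (a₁ := ⟨_, modelDist_X _ hf⟩) ?_)
  rw [sTransform_modelDist hf, eq_comm, PowerSeries.eq_inv_iff_mul_eq_one (by simp [hf]),
    PowerSeries.mul_inv_cancel _ (by simp [hS])]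

/-! ## The full Fock space -/

section Fock

variable {ι : Type u}

/-- The algebraic full Fock space over a set `ι` of letters. -/
abbrev Fock (ι : Type u) : Type u := List ι →₀ ℂ

/-- The vacuum vector. -/
def vacuum : Fock ι := Finsupp.single [] 1

/-- The vacuum state. -/
def vacuumCoeff : Fock ι →ₗ[ℂ] ℂ := Finsupp.lapply []

/-- The creation operator of the letter `i`. -/
def create (i : ι) : Module.End ℂ (Fock ι) := Finsupp.lmapDomain ℂ ℂ (List.cons i)

/-- The annihilation operator of the letter `i`. -/
def annihilate (i : ι) : Module.End ℂ (Fock ι) :=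
  Finsupp.lcomapDomain (List.cons i) List.cons_injective

theorem annihilate_apply (i : ι) (v : Fock ι) (w : List ι) : annihilate i v w = v (i :: w) := rfl

@[simp] theorem annihilate_create (i : ι) (v : Fock ι) : annihilate i (create i v) = v :=
  Finsupp.leftInverse_lcomapDomain_mapDomain (R := ℂ) (List.cons i) List.cons_injective v

theorem annihilate_create_of_ne {i j : ι} (h : i ≠ j) (v : Fock ι) :
    annihilate i (create j v) = 0 := by
  ext w
  rw [annihilate_apply]
  exact Finsupp.mapDomain_of_notMem_range _ _ (by rintro ⟨x, hx⟩; exact h (List.cons.inj hx).1.symm)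

@[simp] theorem annihilate_vacuum (i : ι) : annihilate i (vacuum : Fock ι) = 0 := by
  ext w
  rw [annihilate_apply]
  exact Finsupp.single_eq_of_ne (by simp)

@[simp] theorem vacuumCoeff_vacuum : vacuumCoeff (vacuum : Fock ι) = 1 := Finsupp.single_eq_same

@[simp] theorem vacuumCoeff_create (i : ι) (v : Fock ι) : vacuumCoeff (create i v) = 0 :=
  Finsupp.mapDomain_of_notMem_range _ _ (by rintro ⟨x, hx⟩; simp at hx)

theorem annihilate_pow_apply (i : ι) (n : ℕ) (v : Fock ι) (w : List ι) :
    (annihilate i ^ n) v w = v (List.replicate n i ++ w) := by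
  induction n generalizing v with
  | zero => rfl
  | succ n ih => rw [pow_succ, Module.End.mul_apply, ih, annihilate_apply]; rfl

/-- A vector has finite support, so its words have bounded length and stripping more letters than
that leaves nothing. -/
theorem locallyNilpotent_annihilate (i : ι) : LocallyNilpotent (annihilate i) := by
  intro v
  refine ⟨v.support.sup List.length + 1, Finsupp.ext fun w => ?_⟩
  rw [annihilate_pow_apply, Finsupp.zero_apply, ← Finsupp.notMem_support_iff]
  intro h
  have := Finset.le_sup (f := List.length) h
  rw [List.length_append, List.length_replicate] at this
  omega

/-- The operator `(1 + lᵢ) f(lᵢ*)` on the full Fock space. -/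
def fockOp (f : PowerSeries ℂ) (i : ι) : Module.End ℂ (Fock ι) :=
  (1 + create i) * seriesEval (locallyNilpotent_annihilate i) f

theorem fockOp_apply (f : PowerSeries ℂ) (i : ι) (v : Fock ι) : fockOp f i v =
    (1 + create i) (seriesEval (locallyNilpotent_annihilate i) f v) := rfl

/-- The linear map `p ↦ p(T) v`. -/
def orbitMap (T : Module.End ℂ (Fock ι)) (v : Fock ι) : ℂ[X] →ₗ[ℂ] Fock ι :=
  (LinearMap.applyₗ v).comp (Polynomial.aeval T).toLinearMap

theorem orbitMap_apply (T : Module.End ℂ (Fock ι)) (v : Fock ι) (p : ℂ[X]) :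
    orbitMap T v p = Polynomial.aeval T p v := rfl

theorem orbitMap_one_add_X_mul (T : Module.End ℂ (Fock ι)) (v : Fock ι) (p : ℂ[X]) :
    orbitMap T v ((1 + Polynomial.X) * p) = (1 + T) (orbitMap T v p) := by
  simp [orbitMap_apply]

/-- If `D` inverts `T` up to `S` and kills `S v`, then `p ↦ S p(T) v` turns the backward shift
into `D`. -/
theorem apply_orbitMap {D S T : Module.End ℂ (Fock ι)} {v : Fock ι}
    (h : ∀ x, D (S (T x)) = S x) (h0 : D (S v) = 0) (p : ℂ[X]) :
    D ((S ∘ₗ orbitMap T v) p) = (S ∘ₗ orbitMap T v) (divXHom p) := by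
  conv_lhs => rw [← Polynomial.X_mul_divX_add p]
  simp only [LinearMap.comp_apply, orbitMap_apply, map_add, map_mul, Polynomial.aeval_X,
    Module.End.mul_apply, h, Polynomial.aeval_C,
    Algebra.algebraMap_eq_smul_one, LinearMap.smul_apply, Module.End.one_apply, map_smul, h0,
    smul_zero, add_zero]
  rfl

/-- Above a vector `v` killed by `lᵢ*`, the vectors `p(lᵢ) v` form an image of `ℂ[X]` on which `lᵢ`
acts as multiplication by `X` and `lᵢ*` as the backward shift. Allowing `v` other than the vacuum is
what the freeness proof needs. -/
theorem fockOp_orbitMap (f : PowerSeries ℂ) {i : ι} {v : Fock ι} (hv : annihilate i v = 0)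
    (p : ℂ[X]) : fockOp f i (orbitMap (create i) v p) = orbitMap (create i) v (modelOp f p) := by
  have h := apply_orbitMap (D := annihilate i) (S := 1) (T := create i) (v := v)
    (fun x => annihilate_create i x) hv
  have h' := seriesEval_intertwine (locallyNilpotent_annihilate i) locallyNilpotent_divXHom
    (J := orbitMap (create i) v) h f p
  rw [fockOp_apply, h', modelOp_apply, orbitMap_one_add_X_mul]

theorem aeval_fockOp_apply (f : PowerSeries ℂ) {i : ι} {v : Fock ι} (hv : annihilate i v = 0)
    (q : ℂ[X]) : Polynomial.aeval (fockOp f i) q v =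
      orbitMap (create i) v (Polynomial.aeval (modelOp f) q 1) := by
  rw [← aeval_intertwine (fockOp_orbitMap f hv)]
  simp [orbitMap_apply]

/-- The vacuum expectation. -/
def vacuumState : Module.End ℂ (Fock ι) →ₗ[ℂ] ℂ := vacuumCoeff.comp (LinearMap.applyₗ vacuum)

theorem vacuumState_apply (T : Module.End ℂ (Fock ι)) :
    vacuumState T = vacuumCoeff (T vacuum) := rfl

theorem vacuumState_one : vacuumState (1 : Module.End ℂ (Fock ι)) = 1 := vacuumCoeff_vacuum

theorem vacuumCoeff_orbitMap {T : Module.End ℂ (Fock ι)} (hT : ∀ x, vacuumCoeff (T x) = 0)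
    (p : ℂ[X]) : vacuumCoeff (orbitMap T vacuum p) = p.coeff 0 := by
  conv_lhs => rw [← Polynomial.X_mul_divX_add p]
  simp only [orbitMap_apply, map_add, map_mul, Polynomial.aeval_X,
    Module.End.mul_apply, hT, Polynomial.aeval_C, Algebra.algebraMap_eq_smul_one,
    LinearMap.smul_apply, Module.End.one_apply, map_smul, vacuumCoeff_vacuum, zero_add,
    smul_eq_mul, mul_one]

theorem vacuumState_aeval_fockOp (f : PowerSeries ℂ) (i : ι) (q : ℂ[X]) :
    vacuumState (Polynomial.aeval (fockOp f i) q) = (modelDist f).1 q := by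
  rw [vacuumState_apply, aeval_fockOp_apply f (annihilate_vacuum i),
    vacuumCoeff_orbitMap (vacuumCoeff_create i), modelDist_apply]

theorem hasDistribution_fockOp (f : PowerSeries ℂ) (i : ι) :
    HasDistribution vacuumState (fockOp f i) (modelDist f) := fun n => by
  rw [← vacuumState_aeval_fockOp f i, Polynomial.aeval_X_pow]

/-- A centered polynomial in `fockOp f i` maps vectors killed by `lᵢ*` into the range of `lᵢ`. -/
theorem aeval_fockOp_mem_range (f : PowerSeries ℂ) {i : ι} {v : Fock ι} (hv : annihilate i v = 0)
    {q : ℂ[X]} (hq : vacuumState (Polynomial.aeval (fockOp f i) q) = 0) :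
    Polynomial.aeval (fockOp f i) q v ∈ LinearMap.range (create i) := by
  rw [vacuumState_aeval_fockOp, modelDist_apply] at hq
  rw [aeval_fockOp_apply f hv, ← Polynomial.X_mul_divX_add (Polynomial.aeval (modelOp f) q 1), hq,
    orbitMap_apply]
  simp

/-- Apply an alternating product of centered elements to the vacuum, from the right. Each partial
result starts with the letter of the last operator applied; the next operator has another letter, so
its annihilator kills that vector and centering pushes the image into the range of its own creation
operator. Such a range has no vacuum component. -/
theorem freelyIndependentSets_fockOp {κ : Type*} (i : κ → ι) (hi : Function.Injective i)
    (f : κ → PowerSeries ℂ) (s : κ → Set (Module.End ℂ (Fock ι)))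
    (hs : ∀ k, s k = {fockOp (f k) (i k)}) : FreelyIndependentSets vacuumState s := by
  intro l hl hmem hchain
  have key : ∀ l : List (κ × Module.End ℂ (Fock ι)),
      (∀ p ∈ l, p.2 ∈ Algebra.adjoin ℂ (s p.1) ∧ vacuumState p.2 = 0) →
      l.IsChain (fun p q => p.1 ≠ q.1) → ∀ p ∈ l.head?,
      (l.map Prod.snd).prod vacuum ∈ LinearMap.range (create (i p.1)) := by
    intro l
    induction l with
    | nil => simp
    | cons p l ih =>
      intro hmem hchain p' hp'
      obtain rfl : p = p' := by simpa using hp'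
      have hv : annihilate (i p.1) ((l.map Prod.snd).prod vacuum) = 0 := by
        cases l with
        | nil => exact annihilate_vacuum _
        | cons q l =>
          obtain ⟨x, hx⟩ := ih (fun r hr => hmem r (List.mem_cons_of_mem _ hr))
            (List.isChain_cons_cons.1 hchain).2 q rfl
          rw [← hx, annihilate_create_of_ne]
          exact fun h => (List.isChain_cons_cons.1 hchain).1 (hi h)
      obtain ⟨hp, hp0⟩ := hmem p List.mem_cons_self
      rw [hs, Algebra.adjoin_singleton_eq_range_aeval] at hp
      obtain ⟨q, hq⟩ := hp
      have hq' : Polynomial.aeval (fockOp (f p.1) (i p.1)) q = p.2 := hq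
      rw [List.map_cons, List.prod_cons, Module.End.mul_apply, ← hq']
      exact aeval_fockOp_mem_range _ hv (by rw [hq', hp0])
  obtain ⟨p, l, rfl⟩ := List.exists_cons_of_ne_nil hl
  obtain ⟨x, hx⟩ := key _ hmem hchain p rfl
  rw [vacuumState_apply, ← hx, vacuumCoeff_create]

/-- Haagerup's computation. With `1 + T = (1 + lᵢ)(1 + lⱼ)`, both `lⱼ*` on the vectors `p(T)Ω` and
`lᵢ*` on the vectors `(1 + lⱼ) p(T)Ω` act as the backward shift of `p`. Hence the product sends
`p(T)Ω` to `(1 + T) (f g)(∂)p (T) Ω`, exactly as the one-letter model of `f g` does with `T` in the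
role of `X`. -/
theorem hasDistribution_fockOp_mul (f g : PowerSeries ℂ) {i j : ι} (hij : i ≠ j) :
    HasDistribution vacuumState (fockOp f i * fockOp g j) (modelDist (f * g)) := by
  set T : Module.End ℂ (Fock ι) := create i + create j + create i * create j with hT
  have hfac : (1 + create i) * (1 + create j) = 1 + T := by rw [hT]; noncomm_ring
  have hj : ∀ x, annihilate j (T x) = x := fun x => by
    simp [hT, annihilate_create_of_ne hij.symm]
  have hi : ∀ x, annihilate i ((1 + create j) (T x)) = (1 + create j) x := fun x => by
    simp [hT, annihilate_create_of_ne hij]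
  have h0 : annihilate i ((1 + create j) vacuum) = 0 := by
    simp [annihilate_create_of_ne hij]
  have hJ := seriesEval_intertwine (locallyNilpotent_annihilate j) locallyNilpotent_divXHom
    (J := orbitMap T vacuum)
    (apply_orbitMap (S := 1) (fun x => hj x) (annihilate_vacuum j)) g
  have hK := seriesEval_intertwine (locallyNilpotent_annihilate i) locallyNilpotent_divXHom
    (J := (1 + create j) ∘ₗ orbitMap T vacuum) (apply_orbitMap hi h0) f
  have key : ∀ p, (fockOp f i * fockOp g j) (orbitMap T vacuum p) =
      orbitMap T vacuum (modelOp (f * g) p) := by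
    intro p
    rw [Module.End.mul_apply, fockOp_apply g, hJ, fockOp_apply f]
    have := hK (seriesEval locallyNilpotent_divXHom g p)
    rw [LinearMap.comp_apply] at this
    rw [this, LinearMap.comp_apply, ← Module.End.mul_apply, hfac, modelOp_apply,
      orbitMap_one_add_X_mul, seriesEval_mul]
  intro n
  have hpow := aeval_intertwine key (Polynomial.X ^ n) 1
  rw [modelDist_apply, ← vacuumCoeff_orbitMap (T := T) (fun x => by simp [hT]), ← hpow,
    vacuumState_apply]
  simp [orbitMap_apply]

end Fock

/-! ## Free independence determines joint moments -/

section Unique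

variable {κ A A' : Type*} [Ring A] [Algebra ℂ A] [Ring A'] [Algebra ℂ A']
  {φ : A →ₗ[ℂ] ℂ} {φ' : A' →ₗ[ℂ] ℂ} {x : κ → A} {x' : κ → A'}

theorem state_aeval_eq (h : ∀ k n, φ (x k ^ n) = φ' (x' k ^ n)) (k : κ) (q : ℂ[X]) :
    φ (Polynomial.aeval (x k) q) = φ' (Polynomial.aeval (x' k) q) := by
  induction q using Polynomial.induction_on' with
  | add p q hp hq => simp only [map_add, hp, hq]
  | monomial n a =>
    simp only [Polynomial.aeval_monomial, Algebra.algebraMap_eq_smul_one, smul_mul_assoc, one_mul,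
      map_smul, h]

/-- Working in `A × A'` guarantees that the same polynomial is used on both sides. -/
theorem mem_adjoin_pair {k : κ} {c : A × A'}
    (hc : c ∈ Algebra.adjoin ℂ {((x k, x' k) : A × A')}) :
    ∃ q : ℂ[X], c = (Polynomial.aeval (x k) q, Polynomial.aeval (x' k) q) := by
  rw [Algebra.adjoin_singleton_eq_range_aeval] at hc
  obtain ⟨q, rfl⟩ := hc
  exact ⟨q, Prod.ext (Polynomial.aeval_algHom_apply (AlgHom.fst ℂ A A') (x k, x' k) q).symm
    (Polynomial.aeval_algHom_apply (AlgHom.snd ℂ A A') (x k, x' k) q).symm⟩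

variable (φ x x') in
/-- The span of the alternating products of centered elements of the algebras generated by the
pairs `(x k, x' k)`, the empty product included. -/
def alternatingSpan : Submodule ℂ (A × A') :=
  Submodule.span ℂ {c | ∃ l : List (κ × (A × A')),
    (∀ p ∈ l, p.2 ∈ Algebra.adjoin ℂ {((x p.1, x' p.1) : A × A')} ∧ φ p.2.1 = 0) ∧
    l.IsChain (fun p q => p.1 ≠ q.1) ∧ c = (l.map Prod.snd).prod}

theorem one_mem_alternatingSpan : (1 : A × A') ∈ alternatingSpan φ x x' :=
  Submodule.subset_span ⟨[], by simp, List.isChain_nil, rfl⟩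

/-- Write `c` as its centering plus the scalar `φ(c)`: the first summand prolongs the alternating
word, the second leaves it unchanged. -/
theorem mul_mem_alternatingSpan_of_head (h1 : φ 1 = 1) {k : κ} {c : A × A'}
    (hc : c ∈ Algebra.adjoin ℂ {((x k, x' k) : A × A')}) {l : List (κ × (A × A'))}
    (hl : ∀ p ∈ l, p.2 ∈ Algebra.adjoin ℂ {((x p.1, x' p.1) : A × A')} ∧ φ p.2.1 = 0)
    (hchain : l.IsChain (fun p q => p.1 ≠ q.1)) (hhead : ∀ p ∈ l.head?, k ≠ p.1) :
    c * (l.map Prod.snd).prod ∈ alternatingSpan φ x x' := by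
  have hdec : c * (l.map Prod.snd).prod =
      (((k, c - φ c.1 • 1) :: l).map Prod.snd).prod + φ c.1 • (l.map Prod.snd).prod := by
    simp [sub_mul]
  rw [hdec]
  refine add_mem (Submodule.subset_span ⟨_, ?_, List.isChain_cons.2 ⟨hhead, hchain⟩, rfl⟩)
    (Submodule.smul_mem _ _ (Submodule.subset_span ⟨l, hl, hchain, rfl⟩))
  intro p hp
  rcases List.mem_cons.1 hp with rfl | hp
  · exact ⟨sub_mem hc (Subalgebra.smul_mem _ (one_mem _) _), by simp [h1]⟩
  · exact hl p hp

theorem mul_mem_alternatingSpan (h1 : φ 1 = 1) {k : κ} {c d : A × A'}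
    (hc : c ∈ Algebra.adjoin ℂ {((x k, x' k) : A × A')}) (hd : d ∈ alternatingSpan φ x x') :
    c * d ∈ alternatingSpan φ x x' := by
  induction hd using Submodule.span_induction with
  | zero => rw [mul_zero]; exact zero_mem _
  | add y z _ _ hy hz => rw [mul_add]; exact add_mem hy hz
  | smul r y _ hy => rw [mul_smul_comm]; exact Submodule.smul_mem _ _ hy
  | mem d hd =>
    obtain ⟨l, hl, hchain, rfl⟩ := hd
    by_cases hhead : ∀ p ∈ l.head?, k ≠ p.1
    · exact mul_mem_alternatingSpan_of_head h1 hc hl hchain hhead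
    · cases l with
      | nil => simp at hhead
      | cons p l =>
        -- If the word begins with the same letter, absorb its head into `c`; the remaining tail
        -- begins with a different letter.
        obtain rfl : k = p.1 := by simpa using hhead
        rw [List.map_cons, List.prod_cons, ← mul_assoc]
        refine mul_mem_alternatingSpan_of_head h1 (mul_mem hc (hl p List.mem_cons_self).1)
          (fun q hq => hl q (List.mem_cons_of_mem _ hq)) (List.isChain_cons.1 hchain).2
          (List.isChain_cons.1 hchain).1

/-- Equal moments make an element centered for `φ` also centered for `φ'`, so by freeness both
states vanish on every nonempty alternating product. -/
theorem state_eq_of_mem_alternatingSpan (h1 : φ 1 = 1) (h1' : φ' 1 = 1)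
    (h : ∀ k n, φ (x k ^ n) = φ' (x' k ^ n))
    (hf : FreelyIndependentSets φ fun k => {x k}) (hf' : FreelyIndependentSets φ' fun k => {x' k})
    {c : A × A'} (hc : c ∈ alternatingSpan φ x x') : φ c.1 = φ' c.2 := by
  induction hc using Submodule.span_induction with
  | zero => simp
  | add y z _ _ hy hz => simp [hy, hz]
  | smul r y _ hy => simp [hy]
  | mem d hd =>
    obtain ⟨l, hl, hchain, rfl⟩ := hd
    rcases eq_or_ne l [] with rfl | hne
    · simp [h1, h1']
    · have hfst := hf (l.map fun p => (p.1, p.2.1)) (by simpa using hne) (by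
        intro p hp
        obtain ⟨r, hr, rfl⟩ := List.mem_map.1 hp
        obtain ⟨hr1, hr2⟩ := hl r hr
        obtain ⟨q, hq⟩ := mem_adjoin_pair hr1
        refine ⟨?_, hr2⟩
        rw [hq]
        exact (Algebra.adjoin_singleton_eq_range_aeval ℂ (x r.1)).ge ⟨q, rfl⟩)
        (by rw [List.isChain_map]; exact hchain)
      have hsnd := hf' (l.map fun p => (p.1, p.2.2)) (by simpa using hne) (by
        intro p hp
        obtain ⟨r, hr, rfl⟩ := List.mem_map.1 hp
        obtain ⟨hr1, hr2⟩ := hl r hr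
        obtain ⟨q, hq⟩ := mem_adjoin_pair hr1
        refine ⟨?_, ?_⟩
        · rw [hq]
          exact (Algebra.adjoin_singleton_eq_range_aeval ℂ (x' r.1)).ge ⟨q, rfl⟩
        · rw [hq] at hr2 ⊢
          exact (state_aeval_eq h r.1 q).symm.trans hr2) (by rw [List.isChain_map]; exact hchain)
      have e1 : (l.map Prod.snd).prod.1 = ((l.map fun p => (p.1, p.2.1)).map Prod.snd).prod := by
        refine (map_list_prod (RingHom.fst A A') _).trans ?_
        rw [List.map_map, List.map_map]; rfl
      have e2 : (l.map Prod.snd).prod.2 = ((l.map fun p => (p.1, p.2.2)).map Prod.snd).prod := by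
        refine (map_list_prod (RingHom.snd A A') _).trans ?_
        rw [List.map_map, List.map_map]; rfl
      rw [e1, e2, hfst, hsnd]

theorem state_mul_pow_eq (h1 : φ 1 = 1) (h1' : φ' 1 = 1)
    (h : ∀ k n, φ (x k ^ n) = φ' (x' k ^ n))
    (hf : FreelyIndependentSets φ fun k => {x k}) (hf' : FreelyIndependentSets φ' fun k => {x' k})
    (i j : κ) (n : ℕ) : φ ((x i * x j) ^ n) = φ' ((x' i * x' j) ^ n) := by
  have hmem : (((x i, x' i) : A × A') * (x j, x' j)) ^ n ∈ alternatingSpan φ x x' := by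
    induction n with
    | zero => rw [pow_zero]; exact one_mem_alternatingSpan
    | succ n ih =>
      rw [pow_succ', mul_assoc]
      exact mul_mem_alternatingSpan h1 (Algebra.self_mem_adjoin_singleton ℂ _)
        (mul_mem_alternatingSpan h1 (Algebra.self_mem_adjoin_singleton ℂ _) ih)
  exact state_eq_of_mem_alternatingSpan h1 h1' h hf hf' hmem

end Unique

/-! ## The group `(G₁, ⊠)` -/

theorem IsFreeProductDistribution.unique {μ ν ρ ρ' : Distribution}
    (h : IsFreeProductDistribution.{u} μ ν ρ) (h' : IsFreeProductDistribution.{v} μ ν ρ') :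
    ρ = ρ' := by
  obtain ⟨A, _, _, φ, a, b, h1, ha, hb, hf, hab⟩ := h
  obtain ⟨A', _, _, φ', a', b', h1', ha', hb', hf', hab'⟩ := h'
  refine distribution_ext fun n => ?_
  have e : (![{a}, {b}] : Fin 2 → Set A) = fun k => {![a, b] k} := by
    funext k; fin_cases k <;> rfl
  have e' : (![{a'}, {b'}] : Fin 2 → Set A') = fun k => {![a', b'] k} := by
    funext k; fin_cases k <;> rfl
  rw [e] at hf
  rw [e'] at hf'
  rw [← hab n, ← hab' n]
  refine state_mul_pow_eq h1 h1' (fun k m => ?_) hf hf' 0 1 n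
  fin_cases k
  · exact (ha m).trans (ha' m).symm
  · exact (hb m).trans (hb' m).symm

/-- Two letters suffice; `ULift` places the Fock space in the requested universe. -/
theorem isFreeProductDistribution_modelDist (f g : PowerSeries ℂ) :
    IsFreeProductDistribution.{u} (modelDist f) (modelDist g) (modelDist (f * g)) := by
  let i : Fin 2 → ULift.{u} (Fin 2) := ULift.up
  have hi : Function.Injective i := ULift.up_injective
  refine ⟨Module.End ℂ (Fock (ULift.{u} (Fin 2))), inferInstance, inferInstance, vacuumState,
    fockOp f (i 0), fockOp g (i 1), vacuumState_one, hasDistribution_fockOp f _,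
    hasDistribution_fockOp g _, freelyIndependentSets_fockOp i hi ![f, g] _ fun k => ?_,
    hasDistribution_fockOp_mul f g (hi.ne (by decide))⟩
  fin_cases k <;> rfl

theorem isFreeProductDistribution_model (μ ν : G₁) : IsFreeProductDistribution.{u} μ ν
    (modelDist ((sTransform μ)⁻¹ * (sTransform ν)⁻¹)) := by
  have h := isFreeProductDistribution_modelDist.{u} (sTransform μ)⁻¹ (sTransform ν)⁻¹
  rwa [modelDist_inv_sTransform, modelDist_inv_sTransform] at h

theorem freeMulConv_eq (μ ν : G₁) :
    freeMulConv μ ν = modelDist ((sTransform μ)⁻¹ * (sTransform ν)⁻¹) :=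
  IsFreeProductDistribution.unique
    (Classical.epsilon_spec ⟨_, isFreeProductDistribution_model.{0} μ ν⟩)
    (isFreeProductDistribution_model.{0} μ ν)

/-- `freeMulConv` is chosen among realizations in universe `0`, but the explicit model distribution
is realized in every universe and so identifies the outcome everywhere. -/
theorem isFreeProductDistribution_iff (μ ν : G₁) (ρ : Distribution) :
    IsFreeProductDistribution.{u} μ ν ρ ↔ ρ = freeMulConv μ ν := by
  rw [freeMulConv_eq]
  exact ⟨fun h => h.unique (isFreeProductDistribution_model.{u} μ ν),
    fun h => h ▸ isFreeProductDistribution_model.{u} μ ν⟩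

theorem constantCoeff_inv_sTransform (μ : G₁) :
    PowerSeries.constantCoeff (sTransform μ)⁻¹ = 1 := by
  simp [constantCoeff_sTransform μ]

/-- The element of `G₁` with a given `S`-transform. -/
def ofSTransform (s : PowerSeries ℂ) (hs : PowerSeries.constantCoeff s = 1) : G₁ :=
  ⟨modelDist s⁻¹, modelDist_X _ (by simp [hs])⟩

theorem coe_ofSTransform (s : PowerSeries ℂ) (hs : PowerSeries.constantCoeff s = 1) :
    (ofSTransform s hs : Distribution) = modelDist s⁻¹ := rfl

theorem sTransform_ofSTransform (s : PowerSeries ℂ) (hs : PowerSeries.constantCoeff s = 1) :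
    sTransform (ofSTransform s hs) = s := by
  rw [ofSTransform, sTransform_modelDist (by simp [hs]), eq_comm,
    PowerSeries.eq_inv_iff_mul_eq_one (by simp [hs]), PowerSeries.mul_inv_cancel _ (by simp [hs])]

/-- The multiplication `⊠` of `G₁`. -/
abbrev mulG₁ : Mul G₁ := ⟨fun μ ν => ⟨freeMulConv μ ν, by
  rw [freeMulConv_eq]
  exact modelDist_X _ (by simp [constantCoeff_sTransform])⟩⟩

attribute [local instance] mulG₁

theorem coe_mul (μ ν : G₁) : ((μ * ν : G₁) : Distribution) = freeMulConv μ ν := rfl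

theorem sTransform_mul (μ ν : G₁) : sTransform (μ * ν) = sTransform μ * sTransform ν := by
  have hc : PowerSeries.constantCoeff (sTransform μ * sTransform ν) = 1 := by
    simp [constantCoeff_sTransform]
  have h : μ * ν = ofSTransform (sTransform μ * sTransform ν) hc :=
    Subtype.ext (by rw [coe_mul, freeMulConv_eq, coe_ofSTransform, PowerSeries.mul_inv_rev, mul_comm])
  rw [h, sTransform_ofSTransform]

/-- The group `(G₁, ⊠)`. -/
abbrev groupG₁ : Group G₁ :=
  letI : One G₁ := ⟨ofSTransform 1 (map_one _)⟩
  letI : Inv G₁ := ⟨fun μ => ofSTransform (sTransform μ)⁻¹ (constantCoeff_inv_sTransform μ)⟩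
  have h1 : sTransform (1 : G₁) = 1 := sTransform_ofSTransform _ _
  -- All axioms are pulled back from multiplication of power series along the injective
  -- `S`-transform.
  Group.ofLeftAxioms
    (fun μ ν ρ => sTransform_injective (by simp only [sTransform_mul, mul_assoc]))
    (fun μ => sTransform_injective (by rw [sTransform_mul, h1, one_mul]))
    (fun μ => sTransform_injective (by
      rw [sTransform_mul, show sTransform μ⁻¹ = (sTransform μ)⁻¹ from sTransform_ofSTransform _ _,
        h1, PowerSeries.inv_mul_cancel _ (by simp [constantCoeff_sTransform])]))

end FreeProb

namespace SymFun
open MvPowerSeries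

/-! ## Elementary symmetric functions -/

open Classical in
/-- The elementary symmetric function `e_n`: the sum of all squarefree monomials of degree `n`. -/
def esymm (n : ℕ) : Sym :=
  ⟨fun m => if m.degree = n ∧ ∀ x, m x ≤ 1 then 1 else 0, by
    refine mem_Sym (fun σ m => ?_) n fun m hm => if_neg (by omega)
    change (if _ then (1 : ℂ) else 0) = if _ then 1 else 0
    have h : (∀ x, (m.embDomain σ.toEmbedding) x ≤ 1) ↔ ∀ x, m x ≤ 1 :=
      ⟨fun h x => (Finsupp.embDomain_apply_self σ.toEmbedding m x).symm.trans_le (h (σ x)),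
        fun h x => by
          obtain ⟨y, rfl⟩ := σ.surjective x
          exact (Finsupp.embDomain_apply_self σ.toEmbedding m y).trans_le (h y)⟩
    exact if_congr (by rw [degree_embDomain, h]) rfl rfl⟩

open Classical in
theorem coeff_esymm (n : ℕ) (m : ℕ →₀ ℕ) :
    coeff m (esymm n).1 = if m.degree = n ∧ ∀ x, m x ≤ 1 then 1 else 0 := rfl

theorem coeff_hsymm (n : ℕ) (m : ℕ →₀ ℕ) :
    coeff m (hsymm n).1 = if m.degree = n then 1 else 0 := rfl

/-- The exponent of the squarefree monomial `∏ i ∈ t, x_i`. -/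
def indicatorExp {σ : Type*} (t : Finset σ) : σ →₀ ℕ := ∑ i ∈ t, Finsupp.single i 1

theorem indicatorExp_apply {σ : Type*} [DecidableEq σ] (t : Finset σ) (x : σ) :
    indicatorExp t x = if x ∈ t then 1 else 0 := by
  simp [indicatorExp, Finsupp.finsetSum_apply, Finsupp.single_apply]

theorem degree_indicatorExp {σ : Type*} (t : Finset σ) : (indicatorExp t).degree = t.card := by
  simp [indicatorExp]

theorem support_indicatorExp {σ : Type*} (t : Finset σ) : (indicatorExp t).support = t := by
  classical
  ext x
  rw [Finsupp.mem_support_iff, indicatorExp_apply]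
  simp

theorem indicatorExp_support {σ : Type*} {m : σ →₀ ℕ} (h : ∀ x, m x ≤ 1) :
    indicatorExp m.support = m := by
  classical
  ext x
  rw [indicatorExp_apply]
  have := h x
  split_ifs with hx
  · have := Finsupp.mem_support_iff.1 hx; omega
  · exact (Finsupp.notMem_support_iff.1 hx).symm

theorem coeff_mvPolynomial_esymm {N : ℕ} (k : ℕ) (m : Fin N →₀ ℕ) :
    MvPolynomial.coeff m (MvPolynomial.esymm (Fin N) ℂ k) =
      if m.degree = k ∧ ∀ x, m x ≤ 1 then 1 else 0 := by
  classical
  rw [MvPolynomial.esymm_eq_sum_monomial, MvPolynomial.coeff_sum]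
  change ∑ t ∈ _, MvPolynomial.coeff m (MvPolynomial.monomial (indicatorExp t) 1) = _
  simp only [MvPolynomial.coeff_monomial]
  split_ifs with h
  · rw [Finset.sum_eq_single m.support, if_pos (indicatorExp_support h.2)]
    · intro t _ ht
      exact if_neg fun h' => ht (by rw [← h', support_indicatorExp])
    · intro hm
      refine absurd (Finset.mem_powersetCard.2 ⟨Finset.subset_univ _, ?_⟩) hm
      rw [← degree_indicatorExp, indicatorExp_support h.2, h.1]
  · refine Finset.sum_eq_zero fun t ht => if_neg ?_
    rintro rfl
    refine h ⟨by rw [degree_indicatorExp, (Finset.mem_powersetCard.1 ht).2], fun x => ?_⟩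
    rw [indicatorExp_apply]; split_ifs <;> omega

/-! ## Restriction to finitely many variables -/

/-- Setting all variables but the first `N` to zero. -/
def restrict (N : ℕ) : MvPowerSeries ℕ ℂ →ₐ[ℂ] MvPowerSeries (Fin N) ℂ :=
  killCompl Fin.valEmbedding

theorem coeff_restrict {N : ℕ} (m : Fin N →₀ ℕ) (f : MvPowerSeries ℕ ℂ) :
    coeff m (restrict N f) = coeff (m.embDomain Fin.valEmbedding) f := rfl

open Classical in
theorem restrict_esymm (N k : ℕ) :
    restrict N (esymm k).1 = (MvPolynomial.esymm (Fin N) ℂ k : MvPowerSeries (Fin N) ℂ) := by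
  ext m
  rw [coeff_restrict, coeff_esymm, MvPolynomial.coeff_coe, coeff_mvPolynomial_esymm]
  have h : (∀ x, (m.embDomain Fin.valEmbedding) x ≤ 1) ↔ ∀ x, m x ≤ 1 := by
    refine ⟨fun h x => (Finsupp.embDomain_apply_self Fin.valEmbedding m x).symm.trans_le (h x),
      fun h x => ?_⟩
    by_cases hx : x ∈ Set.range (Fin.valEmbedding : Fin N ↪ ℕ)
    · obtain ⟨y, rfl⟩ := hx
      exact (Finsupp.embDomain_apply_self Fin.valEmbedding m y).trans_le (h y)
    · rw [Finsupp.embDomain_of_notMem_range _ _ _ hx]; omega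
  exact if_congr (by rw [degree_embDomain, h]) rfl rfl

/-- A permutation moves the support of `m` into the first `N` variables, so by symmetry this
coefficient survives the restriction. -/
theorem exists_coeff_restrict {N : ℕ} {m : ℕ →₀ ℕ} (hm : m.support.card ≤ N) :
    ∃ m' : Fin N →₀ ℕ, ∀ f ∈ Sym, coeff m' (restrict N f) = coeff m f := by
  classical
  obtain ⟨g, hg, hinj⟩ : ∃ g : ℕ → ℕ, (∀ x ∈ m.support, g x < N) ∧ Set.InjOn g m.support := by
    refine ⟨fun x => if h : x ∈ m.support then (m.support.equivFin ⟨x, h⟩).1 else 0,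
      fun x hx => ?_, fun x hx y hy hxy => ?_⟩
    · simp only [dif_pos hx]
      exact lt_of_lt_of_le (Fin.is_lt _) hm
    · simp only [dif_pos (Finset.mem_coe.1 hx), dif_pos (Finset.mem_coe.1 hy)] at hxy
      exact congrArg Subtype.val (m.support.equivFin.injective (Fin.ext hxy))
  obtain ⟨σ, hσ⟩ := exists_perm m.support g hinj
  refine ⟨(m.embDomain σ.toEmbedding).comapDomain Fin.val Fin.val_injective.injOn,
    fun f hf => ?_⟩
  rw [coeff_restrict, ← coeff_embDomain hf σ.toEmbedding m]
  congr 2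
  refine Finsupp.ext fun x => ?_
  by_cases hx : x < N
  · exact (Finsupp.embDomain_apply_self Fin.valEmbedding _ (⟨x, hx⟩ : Fin N)).trans rfl
  · rw [Finsupp.embDomain_of_notMem_range _ _ _ (by rintro ⟨y, rfl⟩; exact hx y.2)]
    obtain ⟨y, rfl⟩ := σ.surjective x
    rw [show (m.embDomain σ.toEmbedding) (σ y) = m y from
      Finsupp.embDomain_apply_self σ.toEmbedding m y]
    by_contra hy
    have hy' : y ∈ m.support := Finsupp.mem_support_iff.2 (Ne.symm hy)
    exact hx (by rw [hσ y hy']; exact hg y hy')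

/-! ## `Sym` is freely generated by the elementary symmetric functions -/

variable {N : ℕ}

/-- The polynomial expression in `e_1, …, e_N`. -/
def esymmEval (N : ℕ) : MvPolynomial (Fin N) ℂ →ₐ[ℂ] Sym :=
  MvPolynomial.aeval fun i => esymm (i + 1)

/-- Links `Sym` to the fundamental theorem on symmetric polynomials in `N` variables. -/
theorem restrict_esymmEval (P : MvPolynomial (Fin N) ℂ) :
    restrict N (esymmEval N P).1 = (((MvPolynomial.esymmAlgHom (Fin N) ℂ N P).1 :
      MvPolynomial (Fin N) ℂ) : MvPowerSeries (Fin N) ℂ) := by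
  have h : ((restrict N).comp Sym.val).comp (esymmEval N) =
      ((MvPolynomial.coeToMvPowerSeries.algHom ℂ).comp
        (MvPolynomial.symmetricSubalgebra (Fin N) ℂ).val).comp
          (MvPolynomial.esymmAlgHom (Fin N) ℂ N) := by
    refine MvPolynomial.algHom_ext fun i => ?_
    simp only [AlgHom.comp_apply, esymmEval, MvPolynomial.esymmAlgHom, MvPolynomial.aeval_X]
    refine (restrict_esymm N (i + 1)).trans ?_
    simp [MvPolynomial.coeToMvPowerSeries.algHom]
  refine (DFunLike.congr_fun h P).trans ?_
  simp [MvPolynomial.coeToMvPowerSeries.algHom]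

theorem restrict_esymmEval_injective {P Q : MvPolynomial (Fin N) ℂ}
    (h : restrict N (esymmEval N P).1 = restrict N (esymmEval N Q).1) : P = Q := by
  rw [restrict_esymmEval, restrict_esymmEval] at h
  exact MvPolynomial.esymmAlgHom_injective ℂ (by simp)
    (Subtype.ext (MvPolynomial.coe_injective _ _ h))

/-- The substitution `x_i ↦ 2 x_i`. -/
def double (σ : Type*) : MvPowerSeries σ ℂ →ₐ[ℂ] MvPowerSeries σ ℂ :=
  rescaleAlgHom fun _ => 2

theorem coeff_double {σ : Type*} (f : MvPowerSeries σ ℂ) (m : σ →₀ ℕ) :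
    coeff m (double σ f) = 2 ^ m.degree * coeff m f := by
  rw [double, rescaleAlgHom_apply, coeff_rescale, Finsupp.prod, Finset.prod_pow_eq_pow_sum,
    Finsupp.degree_apply]

theorem restrict_double (f : MvPowerSeries ℕ ℂ) :
    restrict N (double ℕ f) = double (Fin N) (restrict N f) := by
  ext m
  rw [coeff_restrict, coeff_double, coeff_double, coeff_restrict, degree_embDomain]

theorem double_esymm (k : ℕ) : double ℕ (esymm k).1 = (2 ^ k : ℂ) • (esymm k).1 := by
  ext m
  rw [coeff_double, MvPowerSeries.coeff_smul, coeff_esymm]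
  split_ifs with h
  · rw [h.1]
  · simp

/-- `f` is homogeneous of degree `d`. -/
def IsHomogeneousOfDegree (d : ℕ) (f : MvPowerSeries ℕ ℂ) : Prop :=
  ∀ m : ℕ →₀ ℕ, m.degree ≠ d → coeff m f = 0

/-- The powers of `2` are distinct, so homogeneity becomes an eigenvector condition for an algebra
endomorphism, which is easy to transport through `esymmEval` and `restrict`. -/
theorem isHomogeneousOfDegree_iff (d : ℕ) (f : MvPowerSeries ℕ ℂ) :
    IsHomogeneousOfDegree d f ↔ double ℕ f = (2 ^ d : ℂ) • f := by
  constructor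
  · intro h
    ext m
    rw [coeff_double, MvPowerSeries.coeff_smul]
    by_cases hm : m.degree = d
    · rw [hm]
    · rw [h m hm, mul_zero, mul_zero]
  · intro h m hm
    have h1 := congrArg (coeff m) h
    rw [coeff_double, MvPowerSeries.coeff_smul, ← sub_eq_zero, ← sub_mul] at h1
    refine (mul_eq_zero.1 h1).resolve_left fun h2 => hm ?_
    have h3 : (2 : ℕ) ^ m.degree = 2 ^ d := by exact_mod_cast sub_eq_zero.1 h2
    exact Nat.pow_right_injective le_rfl h3

/-- The substitution `X_i ↦ 2^(i+1) X_i`, which `esymmEval` turns into `double`. -/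
def weightedDouble (N : ℕ) : MvPolynomial (Fin N) ℂ →ₐ[ℂ] MvPolynomial (Fin N) ℂ :=
  MvPolynomial.aeval fun i => (2 ^ (i.1 + 1) : ℂ) • MvPolynomial.X i

theorem double_esymmEval (P : MvPolynomial (Fin N) ℂ) :
    double ℕ (esymmEval N P).1 = (esymmEval N (weightedDouble N P)).1 := by
  have h : ((double ℕ).comp Sym.val).comp (esymmEval N) =
      (Sym.val.comp (esymmEval N)).comp (weightedDouble N) := by
    refine MvPolynomial.algHom_ext fun i => ?_
    simp only [AlgHom.comp_apply, esymmEval, weightedDouble, MvPolynomial.aeval_X, map_smul]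
    exact double_esymm _
  exact DFunLike.congr_fun h P

/-- A monomial of degree `d` involves at most `d` variables, so a homogeneous symmetric function of
degree `d` is determined by its restriction to `d` variables, where the fundamental theorem supplies
`P`. It remains to see that `P(e₁, …, e_d)` is itself homogeneous. -/
theorem exists_esymmEval_eq_of_homogeneous {d : ℕ} {f : Sym} (hf : IsHomogeneousOfDegree d f.1) :
    ∃ P, esymmEval d P = f := by
  classical
  set F := restrict d f.1 with hF
  let p : MvPolynomial (Fin d) ℂ :=
    ∑ m ∈ Finset.finsuppAntidiag Finset.univ d, MvPolynomial.monomial m (coeff m F)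
  have hp : (p : MvPowerSeries (Fin d) ℂ) = F := by
    ext m
    rw [MvPolynomial.coeff_coe, MvPolynomial.coeff_sum]
    simp only [MvPolynomial.coeff_monomial]
    rw [Finset.sum_ite_eq']
    split_ifs with hm
    · rfl
    · rw [hF, coeff_restrict, hf]
      intro h
      rw [degree_embDomain, Finsupp.degree_eq_sum] at h
      exact hm (Finset.mem_finsuppAntidiag.2 ⟨h, Finset.subset_univ _⟩)
  have hsymm : p.IsSymmetric := by
    intro e
    ext m
    obtain ⟨m, rfl⟩ : ∃ m' : Fin d →₀ ℕ, m = m'.mapDomain e :=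
      ⟨m.mapDomain e.symm, by rw [← Finsupp.mapDomain_comp]; simp⟩
    rw [MvPolynomial.coeff_rename_mapDomain _ e.injective, ← MvPolynomial.coeff_coe,
      ← MvPolynomial.coeff_coe, hp, hF, coeff_restrict, coeff_restrict]
    -- A permutation of the `d` variables extends to one of all variables, under which `f` is
    -- invariant.
    rw [← coeff_embDomain f.2 (e.viaEmbedding Fin.valEmbedding).toEmbedding
      (m.embDomain Fin.valEmbedding)]
    congr 2
    simp only [Finsupp.embDomain_eq_mapDomain, ← Finsupp.mapDomain_comp]
    refine Finsupp.mapDomain_congr fun x _ => ?_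
    exact Equiv.Perm.viaEmbedding_apply e Fin.valEmbedding x
  obtain ⟨P, hP⟩ := MvPolynomial.esymmAlgHom_surjective ℂ (σ := Fin d) (n := d) (by simp) ⟨p, hsymm⟩
  have hres : restrict d (esymmEval d P).1 = restrict d f.1 := by
    rw [restrict_esymmEval, hP, hp]
  have hhom : IsHomogeneousOfDegree d (esymmEval d P).1 := by
    rw [isHomogeneousOfDegree_iff, double_esymmEval]
    -- Doubling multiplies the restriction of `f` by `2^d`, and `P` is determined by the restriction
    -- of `P(e₁, …, e_d)`.
    have : weightedDouble d P = (2 ^ d : ℂ) • P := by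
      apply restrict_esymmEval_injective
      rw [← double_esymmEval, restrict_double, hres, ← restrict_double,
        (isHomogeneousOfDegree_iff _ _).1 hf, map_smul, map_smul, ← hres]
      exact (map_smul (restrict d) _ _).symm
    rw [this, map_smul]
    rfl
  refine ⟨P, Subtype.ext (MvPowerSeries.ext fun m => ?_)⟩
  by_cases hm : m.degree = d
  · have hcard : m.support.card ≤ d := by
      rw [← hm, Finsupp.degree_apply, Finset.card_eq_sum_ones]
      exact Finset.sum_le_sum fun x hx => Nat.one_le_iff_ne_zero.2 (Finsupp.mem_support_iff.1 hx)
    obtain ⟨m', hm'⟩ := exists_coeff_restrict hcard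
    rw [← hm' _ (esymmEval d P).2, ← hm' _ f.2, hres]
  · rw [hf m hm, hhom m hm]

/-- The component of degree `k` of a symmetric function. -/
def component (k : ℕ) (f : Sym) : Sym :=
  ⟨fun m => if m.degree = k then coeff m f.1 else 0, by
    refine mem_Sym (fun σ m => ?_) k fun m hm => if_neg (by omega)
    change (if _ then coeff _ f.1 else 0) = if _ then coeff _ f.1 else 0
    rw [degree_embDomain, coeff_embDomain f.2]⟩

theorem coeff_component (k : ℕ) (f : Sym) (m : ℕ →₀ ℕ) :
    coeff m (component k f).1 = if m.degree = k then coeff m f.1 else 0 := rfl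

theorem exists_sum_component_eq (f : Sym) : ∃ d, ∑ k ∈ Finset.range d, component k f = f := by
  obtain ⟨d, hd⟩ := f.2.2
  refine ⟨d + 1, Subtype.ext (MvPowerSeries.ext fun m => ?_)⟩
  rw [AddSubmonoidClass.coe_finsetSum, map_sum]
  simp only [coeff_component, Finset.sum_ite_eq, Finset.mem_range]
  split_ifs with h
  · rfl
  · exact (hd m (by omega)).symm

/-- The algebra map `ℂ[X₀, X₁, …] → Sym`, `X_n ↦ e_{n+1}`. -/
def esymmHom : MvPolynomial ℕ ℂ →ₐ[ℂ] Sym := MvPolynomial.aeval fun n => esymm (n + 1)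

theorem esymmHom_rename (P : MvPolynomial (Fin N) ℂ) :
    esymmHom (MvPolynomial.rename Fin.val P) = esymmEval N P := by
  rw [esymmHom, MvPolynomial.aeval_rename]; rfl

theorem esymmHom_surjective : Function.Surjective esymmHom := by
  intro f
  obtain ⟨d, hd⟩ := exists_sum_component_eq f
  rw [← AlgHom.mem_range, ← hd]
  refine sum_mem fun k _ => ?_
  obtain ⟨P, hP⟩ := exists_esymmEval_eq_of_homogeneous (d := k) (f := component k f)
    fun m hm => if_neg hm
  exact ⟨MvPolynomial.rename Fin.val P, (esymmHom_rename P).trans hP⟩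

theorem exists_rename_val (P : MvPolynomial ℕ ℂ) :
    ∃ (N : ℕ) (Q : MvPolynomial (Fin N) ℂ), P = MvPolynomial.rename Fin.val Q := by
  obtain ⟨n, g, -, Q, rfl⟩ := MvPolynomial.exists_fin_rename P
  refine ⟨Finset.univ.sup g + 1, MvPolynomial.rename
    (fun i => ⟨g i, Nat.lt_succ_of_le (Finset.le_sup (Finset.mem_univ i))⟩) Q, ?_⟩
  rw [MvPolynomial.rename_rename]; rfl

/-- A relation involves finitely many `eₙ`, say `e₁, …, e_N`, which stay independent after
restriction to `N` variables. -/
theorem esymmHom_injective : Function.Injective esymmHom := by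
  rw [injective_iff_map_eq_zero]
  intro P hP
  obtain ⟨N, Q, rfl⟩ := exists_rename_val P
  rw [esymmHom_rename] at hP
  rw [restrict_esymmEval_injective (P := Q) (Q := 0) (by rw [hP, map_zero]), map_zero]

/-! ## The relation between elementary and complete symmetric functions -/

/-- The generating series `∑ (-1)ⁿ e_n zⁿ`. -/
def esymmSeries : PowerSeries Sym := PowerSeries.mk fun n => (-1) ^ n * esymm n

/-- The generating series `∑ h_n zⁿ`. -/
def hsymmSeries : PowerSeries Sym := PowerSeries.mk hsymm

theorem hsymm_zero : hsymm 0 = 1 := by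
  classical
  refine Subtype.ext (MvPowerSeries.ext fun m => ?_)
  rw [coeff_hsymm, OneMemClass.coe_one, coeff_one]
  exact if_congr (Finsupp.degree_eq_zero_iff m) rfl rfl

open Classical in
-- Squarefree divisors of a monomial correspond to subsets of its support, and the signed count of
-- subsets vanishes unless the support is empty.
theorem sum_antidiagonal_squarefree (m : ℕ →₀ ℕ) :
    ∑ p ∈ Finset.HasAntidiagonal.antidiagonal m, (if ∀ x, p.1 x ≤ 1 then (-1 : ℂ) ^ p.1.degree else 0) =
      if m = 0 then 1 else 0 := by
  have h : ∑ t ∈ m.support.powerset, (-1 : ℂ) ^ t.card = if m = 0 then 1 else 0 := by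
    have := congrArg (Int.cast : ℤ → ℂ) (Finset.sum_powerset_neg_one_pow_card (x := m.support))
    push_cast at this
    rw [this]
    simp
  rw [← h, ← Finset.sum_filter]
  refine Finset.sum_bij' (fun p _ => p.1.support) (fun t _ => (indicatorExp t, m - indicatorExp t))
    ?_ ?_ ?_ ?_ ?_
  · rintro ⟨p, q⟩ hp
    obtain ⟨hp, -⟩ := Finset.mem_filter.1 hp
    rw [Finset.HasAntidiagonal.mem_antidiagonal] at hp
    exact Finset.mem_powerset.2 (Finsupp.support_mono (by rw [← hp]; exact le_self_add))
  · intro t ht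
    refine Finset.mem_filter.2 ⟨?_, fun x => ?_⟩
    · rw [Finset.HasAntidiagonal.mem_antidiagonal]
      refine add_tsub_cancel_of_le fun x => ?_
      rw [indicatorExp_apply]
      split_ifs with hx
      · exact Nat.one_le_iff_ne_zero.2 (Finsupp.mem_support_iff.1 (Finset.mem_powerset.1 ht hx))
      · exact Nat.zero_le _
    · rw [indicatorExp_apply]; split_ifs <;> omega
  · rintro ⟨p, q⟩ hp
    obtain ⟨hp, hp1⟩ := Finset.mem_filter.1 hp
    rw [Finset.HasAntidiagonal.mem_antidiagonal] at hp
    have e := indicatorExp_support hp1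
    dsimp only at hp e ⊢
    rw [e, ← hp, add_tsub_cancel_left]
  · intro t _
    exact support_indicatorExp t
  · rintro ⟨p, q⟩ hp
    dsimp only
    rw [← degree_indicatorExp, indicatorExp_support (Finset.mem_filter.1 hp).2]

/-- The coefficient at a monomial `m` is a signed sum over factorizations of `m` with squarefree
first factor; the degrees of the factors determine the pair `(i, j)`, so summing over these pairs
only imposes `deg m = n`. -/
theorem esymmSeries_mul_hsymmSeries : esymmSeries * hsymmSeries = 1 := by
  classical
  ext n : 1
  refine Subtype.ext (MvPowerSeries.ext fun m => ?_)
  rw [PowerSeries.coeff_mul, AddSubmonoidClass.coe_finsetSum, map_sum]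
  have hterm : ∀ x ∈ Finset.HasAntidiagonal.antidiagonal n, coeff m
      (PowerSeries.coeff x.1 esymmSeries * PowerSeries.coeff x.2 hsymmSeries : Sym).1 =
      ∑ p ∈ Finset.HasAntidiagonal.antidiagonal m, if (p.1.degree, p.2.degree) = x then
        (if ∀ x, p.1 x ≤ 1 then (-1 : ℂ) ^ p.1.degree else 0) else 0 := by
    rintro ⟨i, j⟩ _
    have e : (PowerSeries.coeff i esymmSeries * PowerSeries.coeff j hsymmSeries : Sym).1 =
        (-1 : ℂ) ^ i • ((esymm i).1 * (hsymm j).1) := by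
      simp [esymmSeries, hsymmSeries, PowerSeries.coeff_mk, mul_assoc, Algebra.smul_def]
    rw [e, MvPowerSeries.coeff_smul, coeff_mul, Finset.mul_sum]
    refine Finset.sum_congr rfl fun p _ => ?_
    rw [coeff_esymm, coeff_hsymm]
    by_cases h1 : p.1.degree = i <;> by_cases h2 : p.2.degree = j <;>
      by_cases h3 : ∀ x, p.1 x ≤ 1 <;> simp [h1, h2, h3]
  rw [Finset.sum_congr rfl hterm, Finset.sum_comm]
  have hsum : ∀ p ∈ Finset.HasAntidiagonal.antidiagonal m, (∑ x ∈ Finset.HasAntidiagonal.antidiagonal n,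
      if (p.1.degree, p.2.degree) = x then
        (if ∀ x, p.1 x ≤ 1 then (-1 : ℂ) ^ p.1.degree else 0) else 0) =
      if m.degree = n then (if ∀ x, p.1 x ≤ 1 then (-1 : ℂ) ^ p.1.degree else 0) else 0 := by
    intro p hp
    rw [Finset.HasAntidiagonal.mem_antidiagonal] at hp
    rw [Finset.sum_ite_eq]
    simp only [Finset.HasAntidiagonal.mem_antidiagonal, ← hp, map_add]
  rw [Finset.sum_congr rfl hsum, PowerSeries.coeff_one]
  by_cases hm : m.degree = n
  · simp only [hm, if_true]
    rw [sum_antidiagonal_squarefree]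
    by_cases hn : n = 0
    · subst hn
      rw [if_pos rfl, OneMemClass.coe_one, coeff_one]
    · have : m ≠ 0 := by rintro rfl; exact hn (by simpa using hm.symm)
      simp [hn, this]
  · simp only [hm, if_false, Finset.sum_const_zero]
    by_cases hn : n = 0
    · subst hn
      have : m ≠ 0 := by rintro rfl; simp at hm
      rw [if_pos rfl, OneMemClass.coe_one, coeff_one, if_neg this]
    · simp [hn]

/-- A monomial of degree `n` in two alphabets splits uniquely into its `x`-part and its `y`-part,
whose degrees add up to `n`. -/
theorem comul_hsymm (n : ℕ) :
    comul (hsymm n) = ∑ p ∈ Finset.HasAntidiagonal.antidiagonal n, hsymm p.1 ⊗ₜ[ℂ] hsymm p.2 := by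
  classical
  refine split_injective Sym.val Sym.val val_injective val_injective ?_
  rw [split_comul, map_sum]
  ext m
  obtain ⟨α, β, rfl⟩ : ∃ (α β : ℕ →₀ ℕ), m = α.sumElim β :=
    ⟨_, _, (Finsupp.comapDomain_sumElim_comapDomain m).symm⟩
  rw [map_sum, coeff_renameEquiv, coeff_hsymm, degree_embDomain, degree_sumElim]
  have h : ∀ p ∈ Finset.HasAntidiagonal.antidiagonal n,
      coeff (α.sumElim β) (split Sym.val Sym.val (hsymm p.1 ⊗ₜ[ℂ] hsymm p.2)) =
        if (α.degree, β.degree) = p then 1 else 0 := by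
    rintro ⟨i, j⟩ _
    rw [coeff_split_tmul, Subalgebra.coe_val, coeff_hsymm, coeff_hsymm]
    by_cases h1 : α.degree = i <;> by_cases h2 : β.degree = j <;> simp [h1, h2]
  rw [Finset.sum_congr rfl h, Finset.sum_ite_eq]
  simp only [Finset.HasAntidiagonal.mem_antidiagonal]

/-! ## Characters of `Sym` -/

/-- The series `∑ χ(h_n) zⁿ`. -/
def characterSeries (χ : Sym →ₐ[ℂ] ℂ) : PowerSeries ℂ := hsymmSeries.map χ.toRingHom

theorem coeff_characterSeries (χ : Sym →ₐ[ℂ] ℂ) (n : ℕ) :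
    PowerSeries.coeff n (characterSeries χ) = χ (hsymm n) := by
  simp [characterSeries, hsymmSeries]

theorem constantCoeff_characterSeries (χ : Sym →ₐ[ℂ] ℂ) :
    PowerSeries.constantCoeff (characterSeries χ) = 1 := by
  rw [← PowerSeries.coeff_zero_eq_constantCoeff_apply, coeff_characterSeries, hsymm_zero, map_one]

theorem map_esymmSeries (χ : Sym →ₐ[ℂ] ℂ) :
    esymmSeries.map χ.toRingHom = (characterSeries χ)⁻¹ := by
  rw [PowerSeries.eq_inv_iff_mul_eq_one (by simp [constantCoeff_characterSeries]),
    characterSeries, ← map_mul, esymmSeries_mul_hsymmSeries, map_one]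

theorem coeff_inv_characterSeries (χ : Sym →ₐ[ℂ] ℂ) (n : ℕ) :
    PowerSeries.coeff n (characterSeries χ)⁻¹ = (-1) ^ n * χ (esymm n) := by
  rw [← map_esymmSeries]
  simp [esymmSeries]

/-- Inverting the series gives the values on the `eₙ`, which generate `Sym`. -/
theorem characterSeries_injective : Function.Injective characterSeries := by
  intro χ η h
  have he : ∀ n, χ (esymm n) = η (esymm n) := fun n => by
    have h1 := coeff_inv_characterSeries χ n
    rw [h, coeff_inv_characterSeries η n] at h1
    exact (mul_left_cancel₀ (pow_ne_zero n (by norm_num)) h1).symm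
  have hcomp : χ.comp esymmHom = η.comp esymmHom :=
    MvPolynomial.algHom_ext fun n => by simp [esymmHom, he]
  refine AlgHom.ext fun f => ?_
  obtain ⟨P, rfl⟩ := esymmHom_surjective f
  exact DFunLike.congr_fun hcomp P

theorem exists_characterSeries_eq {s : PowerSeries ℂ} (hs : PowerSeries.constantCoeff s = 1) :
    ∃ χ, characterSeries χ = s := by
  let e := AlgEquiv.ofBijective esymmHom ⟨esymmHom_injective, esymmHom_surjective⟩
  -- The values on the free generators are forced by `E(-z) = 1 / H(z)`; the variable `n` stands for
  -- `e_{n+1}`, hence the shift.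
  let χ : Sym →ₐ[ℂ] ℂ := (MvPolynomial.aeval fun n : ℕ =>
    (-1 : ℂ) ^ (n + 1) * PowerSeries.coeff (n + 1) s⁻¹).comp e.symm.toAlgHom
  have hχ : ∀ n, χ (esymm (n + 1)) = (-1) ^ (n + 1) * PowerSeries.coeff (n + 1) s⁻¹ := by
    intro n
    have h : e.symm (esymm (n + 1)) = MvPolynomial.X n := by
      rw [AlgEquiv.symm_apply_eq]
      exact (MvPolynomial.aeval_X (fun n => esymm (n + 1)) n).symm
    change MvPolynomial.aeval _ (e.symm (esymm (n + 1))) = _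
    rw [h, MvPolynomial.aeval_X]
  have hinv : (characterSeries χ)⁻¹ = s⁻¹ := by
    ext n
    cases n with
    | zero => simp [constantCoeff_characterSeries, hs]
    | succ n => rw [coeff_inv_characterSeries, hχ, ← mul_assoc, ← mul_pow]; simp
  refine ⟨χ, ?_⟩
  have h1 := PowerSeries.mul_inv_cancel s (by simp [hs])
  have h2 := PowerSeries.inv_mul_cancel (characterSeries χ)
    (by simp [constantCoeff_characterSeries])
  rw [hinv] at h2
  linear_combination s * h2 - characterSeries χ * h1

theorem characterSeries_mul (χ η : Character) :
    characterSeries (χ * η).ofConv = characterSeries χ.ofConv * characterSeries η.ofConv := by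
  ext n
  rw [coeff_characterSeries, PowerSeries.coeff_mul]
  refine (AlgHom.convMul_apply χ η (hsymm n)).trans ?_
  change Algebra.TensorProduct.lift χ.ofConv η.ofConv _ (comul (hsymm n)) = _
  rw [comul_hsymm, map_sum]
  refine Finset.sum_congr rfl fun p _ => ?_
  rw [Algebra.TensorProduct.lift_tmul, coeff_characterSeries, coeff_characterSeries]

end SymFun

/-! ### The isomorphism from `(G₁, ⊠)` onto the character group -/

section CharacterIsomorphism

attribute [local instance] FreeProb.mulG₁

theorem exists_character (μ : FreeProb.G₁) : ∃ χ, SymFun.characterSeries χ =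
    PowerSeries.rescale (-1) (FreeProb.sTransform μ) :=
  SymFun.exists_characterSeries_eq (by
    rw [← PowerSeries.coeff_zero_eq_constantCoeff_apply, PowerSeries.coeff_rescale]
    simp [FreeProb.constantCoeff_sTransform])

/-- The character `θ_μ` with `θ_μ(h_n) = (-1)ⁿ βₙ(μ)`. -/
def sTransformCharacter (μ : FreeProb.G₁) : SymFun.Character :=
  WithConv.toConv (exists_character μ).choose

theorem characterSeries_sTransformCharacter (μ : FreeProb.G₁) :
    SymFun.characterSeries (sTransformCharacter μ).ofConv =
      PowerSeries.rescale (-1) (FreeProb.sTransform μ) :=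
  (exists_character μ).choose_spec

theorem rescale_neg_one_rescale_neg_one (s : PowerSeries ℂ) :
    PowerSeries.rescale (-1) (PowerSeries.rescale (-1) s) = s := by
  rw [PowerSeries.rescale_rescale]; simp

theorem eq_sTransformCharacter_iff (μ : FreeProb.G₁) (χ : SymFun.Character) :
    χ = sTransformCharacter μ ↔ SymFun.characterSeries χ.ofConv =
      PowerSeries.rescale (-1) (FreeProb.sTransform μ) := by
  rw [← characterSeries_sTransformCharacter]
  exact ⟨fun h => by rw [h],
    fun h => WithConv.ofConv_injective (SymFun.characterSeries_injective h)⟩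

/-- The isomorphism `μ ↦ θ_μ` from `(G₁, ⊠)` onto the character group of `Sym`. -/
def sTransformEquiv : FreeProb.G₁ ≃* SymFun.Character :=
  MulEquiv.ofBijective
    (⟨sTransformCharacter, fun μ ν => by
      rw [eq_comm, eq_sTransformCharacter_iff, SymFun.characterSeries_mul,
        characterSeries_sTransformCharacter, characterSeries_sTransformCharacter,
        FreeProb.sTransform_mul, map_mul]⟩ : FreeProb.G₁ →ₙ* SymFun.Character) (by
    constructor
    · intro μ ν h
      have h1 := (eq_sTransformCharacter_iff ν _).1 h
      change SymFun.characterSeries (sTransformCharacter μ).ofConv = _ at h1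
      rw [characterSeries_sTransformCharacter] at h1
      apply FreeProb.sTransform_injective
      rw [← rescale_neg_one_rescale_neg_one (FreeProb.sTransform μ), h1,
        rescale_neg_one_rescale_neg_one]
    -- The substitution `z ↦ -z` is an involution, so the preimage has the sign-changed character
    -- series as its `S`-transform.
    · intro χ
      refine ⟨FreeProb.ofSTransform
        (PowerSeries.rescale (-1) (SymFun.characterSeries χ.ofConv)) ?_, ?_⟩
      · rw [← PowerSeries.coeff_zero_eq_constantCoeff_apply, PowerSeries.coeff_rescale]
        simp [SymFun.constantCoeff_characterSeries]
      · refine ((eq_sTransformCharacter_iff _ χ).2 ?_).symm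
        rw [FreeProb.sTransform_ofSTransform, rescale_neg_one_rescale_neg_one])

end CharacterIsomorphism

end

theorem proposition6p5 :
    (∀ (μ ν : FreeProb.G₁) (ρ : FreeProb.Distribution),
      FreeProb.IsFreeProductDistribution.{u} μ ν ρ ↔ ρ = FreeProb.freeMulConv μ ν) ∧
    ∃ _ : Group FreeProb.G₁,
      (∀ μ ν : FreeProb.G₁,
        ((μ * ν : FreeProb.G₁) : FreeProb.Distribution) = FreeProb.freeMulConv μ ν) ∧
      ∃ θ : FreeProb.G₁ ≃* SymFun.Character,
        ∀ (μ : FreeProb.G₁) (χ : SymFun.Character),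
          χ = θ μ ↔ ∀ n : ℕ, 1 ≤ n →
            χ.ofConv (SymFun.hsymm n) =
              (-1) ^ n * PowerSeries.coeff n (FreeProb.sTransform μ) := by
  refine ⟨FreeProb.isFreeProductDistribution_iff, FreeProb.groupG₁, FreeProb.coe_mul,
    sTransformEquiv, fun μ χ => (eq_sTransformCharacter_iff μ χ).trans ⟨fun h n _ => ?_,
      fun h => ?_⟩⟩
  · rw [← SymFun.coeff_characterSeries, h, PowerSeries.coeff_rescale]
  · ext n
    rw [SymFun.coeff_characterSeries, PowerSeries.coeff_rescale]
    -- The condition says nothing about `n = 0`, but there both sides equal `1`, because `h₀ = 1`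
    -- and the `S`-transform has constant term `1`.
    rcases Nat.eq_zero_or_pos n with rfl | hn
    · simp [SymFun.hsymm_zero, FreeProb.constantCoeff_sTransform]
    · exact h n hn
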